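/- A Carnot group is a simply connected Lie group $G$ whose Lie algebra is stratified, $\mathfrak g=\mathfrak g^{[1]}\oplus\cdots\oplus\mathfrak g^{[s]}$ with $[\mathfrak g^{[1]},\mathfrak g^{[k]}]=\mathfrak g^{[k+1]}$ for all $k\ge 1$ (where $\mathfrak g^{[k]}=0$ for $k>s$), and carries an inner product for which the layers are pairwise orthogonal. Its rank is $\dim\mathfrak g^{[1]}$, and $d$ denotes its sub-Riemannian distance: the infimum of the lengths of the absolutely continuous curves tangent to the left translates of $\mathfrak g^{[1]}$ that join two points. A map $f$ between subsets of Carnot groups is $\gamma$-Hölder ($0<\gamma\le 1$) if $d(f(x),f(y))\le C\,d(x,y)^{\gamma}$ for some constant $C$ and all $x,y$. A central extension of Carnot groups $V\xrightarrow{\iota}G\xrightarrow{\pi}H$ consists of Carnot groups $G,H$, a finite-dimensional graded inner product space $V$, a 2-cocycle $\rho$ on $\mathfrak h$ with values in $V$ and a linear identification $\mathfrak g=\mathfrak h\oplus V$ under which $[X+A,Y+B]=[X,Y]+\rho(X,Y)$, such that the inclusion $\iota_*:V\to\mathfrak g$ and the projection $\pi_*:\mathfrak g\to\mathfrak h$ are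 graded, $\iota_*$ is an isometry and $\pi_*$ is a submetry, together with the induced short exact sequence of Lie groups. We regard $V$ as a subgroup of $G$ through $\iota$. **Theorem 6.6.** Let $V_1\to G_1\xrightarrow{\pi_1}H_1$ and $V_2\to G_2\xrightarrow{\pi_2}H_2$ be central extensions of Carnot groups such that $\mathrm{rank}(G_2)=\mathrm{rank}(H_2)$, and let $\tfrac12<\beta\le 1$. (a) Let $U_1\subset H_1$ be a domain (a non-empty connected open set), let $f:U_1\to H_2$ be a Hölder map (of some exponent in $(0,1]$), and let $F:\pi_1^{-1}(U_1)\to G_2$ be a $\beta$-Hölder lift of $f$, that is, a $\beta$-Hölder map with $\pi_2\circ F=f\circ\pi_1$. Then there exists a Lie group homomorphism $\Phi:V_1\to V_2$ such that $F(gk)=F(g)\Phi(k)$ for all $g\in\pi_1^{-1}(U_1)$ and all $k\in V_1$. (b) Let $B\subset G_1$ be an open ball for the sub-Riemannian distance. Every map $h:B\to V_2$ that is $\beta$-Hölder with respect to the sub-Riemannian distances of $G_1$ and $G_2$ (the latter restricted to $V_2\subset G_2$) is constant. -/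

import Mathlib

open Set MeasureTheory
open scoped Manifold ContDiff NNReal ENNReal

noncomputable section

universe u v w

/-- A (sub-Riemannian) Carnot group: a simply connected real Lie group whose Lie algebra
(Mathlib's `GroupLieAlgebra`, the tangent space at the identity with the bracket of left-invariant
vector fields) is stratified, `𝔤 = 𝔤^[1] ⊕ ⋯ ⊕ 𝔤^[s]` with `[𝔤^[1], 𝔤^[k]] = 𝔤^[k+1]` for all
`k ≥ 1`, and carries an inner product for which the layers are pairwise orthogonal. The layers are
indexed by `ℕ`, and the layer of index `0` is `{0}`. (Nilpotency follows from the
stratification.) -/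
structure CarnotGroup where
  /-- the underlying set -/
  carrier : Type u
  /-- the dimension of the manifold -/
  dim : ℕ
  [top : TopologicalSpace carrier]
  [charted : ChartedSpace (EuclideanSpace ℝ (Fin dim)) carrier]
  [group : Group carrier]
  [lieGroup : LieGroup 𝓘(ℝ, EuclideanSpace ℝ (Fin dim)) ∞ carrier]
  [t2 : T2Space carrier]
  [simplyConnected : SimplyConnectedSpace carrier]
  /-- the layers `𝔤^[k]` -/
  layer : ℕ → Submodule ℝ (GroupLieAlgebra 𝓘(ℝ, EuclideanSpace ℝ (Fin dim)) carrier)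
  /-- the step `s` -/
  step : ℕ
  layer_zero : layer 0 = ⊥
  layer_eq_bot : ∀ k, step < k → layer k = ⊥
  layer_isInternal : DirectSum.IsInternal layer
  span_bracket : ∀ k, 1 ≤ k →
    Submodule.span ℝ {Z | ∃ X ∈ layer 1, ∃ Y ∈ layer k, ⁅X, Y⁆ = Z} = layer (k + 1)
  /-- the inner product on the Lie algebra -/
  ip : LinearMap.BilinForm ℝ (GroupLieAlgebra 𝓘(ℝ, EuclideanSpace ℝ (Fin dim)) carrier)
  ip_symm : ∀ X Y, ip X Y = ip Y X
  ip_pos : ∀ X, X ≠ 0 → 0 < ip X X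
  ip_orthogonal : ∀ j k, j ≠ k → ∀ X ∈ layer j, ∀ Y ∈ layer k, ip X Y = 0

namespace CarnotGroup

instance : CoeSort CarnotGroup.{u} (Type u) := ⟨carrier⟩

attribute [instance] top charted group lieGroup t2 simplyConnected

variable (G : CarnotGroup.{u}) (H : CarnotGroup.{v})

/-- The model with corners of the manifold `G`. -/
abbrev model : ModelWithCorners ℝ (EuclideanSpace ℝ (Fin G.dim)) (EuclideanSpace ℝ (Fin G.dim)) :=
  𝓘(ℝ, EuclideanSpace ℝ (Fin G.dim))

/-- The Lie algebra `𝔤 = T_e G`. -/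
abbrev LieAlg : Type := GroupLieAlgebra G.model G.carrier

/-- The horizontal rank `dim 𝔤^[1]`. -/
def rank : ℕ := Module.finrank ℝ (G.layer 1)

/-- The norm of the inner product on the Lie algebra. -/
def algNorm (X : G.LieAlg) : ℝ := Real.sqrt (G.ip X X)

/-- The left-trivialized derivative `(L_{γ(t)}⁻¹)_* γ'(t)`. It is a tangent vector at
`γ(t)⁻¹ γ(t) = e`. -/
def leftDeriv (γ : ℝ → G) (t : ℝ) : G.LieAlg :=
  mfderiv G.model G.model (fun x : G => (γ t)⁻¹ * x) (γ t) (mfderiv 𝓘(ℝ, ℝ) G.model γ t (1 : ℝ))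

/-- A horizontal curve on `[0,1]`: an absolutely continuous curve whose left-trivialized derivative
lies in the first layer almost everywhere. Absolute continuity of a curve in a manifold means that
its composition with every smooth real function is absolutely continuous (equivalently, the curve
is continuous and absolutely continuous in charts); only the values on `[0,1]` matter. -/
structure IsHorizontal (γ : ℝ → G) : Prop where
  absolutelyContinuous : ∀ φ : G → ℝ, ContMDiff G.model 𝓘(ℝ, ℝ) ∞ φ →
    AbsolutelyContinuousOnInterval (fun t => φ (γ t)) 0 1
  horizontal : ∀ᵐ t ∂(volume.restrict (Icc (0 : ℝ) 1)), G.leftDeriv γ t ∈ G.layer 1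

/-- The length `∫₀¹ ‖(L_{γ(t)}⁻¹)_* γ'(t)‖ dt`. -/
def length (γ : ℝ → G) : ℝ≥0∞ :=
  ∫⁻ t in Icc (0 : ℝ) 1, ENNReal.ofReal (G.algNorm (G.leftDeriv γ t))

/-- The sub-Riemannian (Carnot-Carathéodory) distance: the infimum of the lengths of the horizontal
curves from `g` to `h`. It takes values in `[0,∞]`, so that no finiteness is built in. -/
def ccDist (g h : G) : ℝ≥0∞ :=
  ⨅ (γ : ℝ → G) (_ : G.IsHorizontal γ ∧ γ 0 = g ∧ γ 1 = h), G.length γ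

/-- The open ball of radius `r` for the sub-Riemannian distance. -/
def ball (x : G) (r : ℝ) : Set G := {g | G.ccDist x g < ENNReal.ofReal r}

variable {G H} in
/-- `f` is `β`-Hölder continuous on `s`, for the sub-Riemannian distances. -/
def IsHolderOn (β : ℝ) (s : Set G) (f : G → H) : Prop :=
  ∃ C : ℝ≥0, ∀ x ∈ s, ∀ y ∈ s, H.ccDist (f x) (f y) ≤ C * G.ccDist x y ^ β

end CarnotGroup

/-- A central extension of Carnot groups `V → G → H` by a `2`-cocycle `ρ`. At the level of Lie
algebras, `𝔤` is identified with `𝔥 ⊕ V` by a linear isomorphism `split` that carries the bracket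
of `𝔤` to `[X + A, Y + B] = [X, Y] + ρ(X, Y)`; so `ι_* v = split⁻¹ (0, v)` and `π_*` is the first
component of `split`. These two maps are graded, `ι_*` is an isometry, and `π_*` is a submetry (it
maps balls onto balls of the same radius). At the level of groups, `incl` and `proj` are the smooth
homomorphisms with differentials `ι_*` and `π_*`, and they form a short exact sequence. -/
structure CentralExtension (V : Type w) [NormedAddCommGroup V] [InnerProductSpace ℝ V]
    [FiniteDimensional ℝ V] (G : CarnotGroup.{u}) (H : CarnotGroup.{v}) where
  /-- the grading of `V` -/
  vlayer : ℕ → Submodule ℝ V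
  vlayer_zero : vlayer 0 = ⊥
  vlayer_isInternal : DirectSum.IsInternal vlayer
  /-- the `2`-cocycle `ρ` -/
  ρ : H.LieAlg →ₗ[ℝ] H.LieAlg →ₗ[ℝ] V
  ρ_alternating : ∀ X, ρ X X = 0
  ρ_cocycle : ∀ X Y Z, ρ ⁅X, Y⁆ Z + ρ ⁅Y, Z⁆ X + ρ ⁅Z, X⁆ Y = 0
  /-- the decomposition `𝔤 = 𝔥 ⊕ V` -/
  split : G.LieAlg ≃ₗ[ℝ] H.LieAlg × V
  split_bracket : ∀ X Y : G.LieAlg,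
    split ⁅X, Y⁆ = (⁅(split X).1, (split Y).1⁆, ρ (split X).1 (split Y).1)
  incl_graded : ∀ k, ∀ v ∈ vlayer k, split.symm (0, v) ∈ G.layer k
  proj_graded : ∀ k, ∀ X ∈ G.layer k, (split X).1 ∈ H.layer k
  incl_isometry : ∀ v v' : V, G.ip (split.symm (0, v)) (split.symm (0, v')) = inner ℝ v v'
  proj_submetry : ∀ (X : G.LieAlg) (r : ℝ), 0 < r →
    (fun X' => (split X').1) '' {X' | G.algNorm (X' - X) < r} =
      {Y | H.algNorm (Y - (split X).1) < r}
  /-- the inclusion `ι : V → G` -/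
  incl : V → G
  incl_add : ∀ v v', incl (v + v') = incl v * incl v'
  incl_smooth : ContMDiff 𝓘(ℝ, V) G.model ∞ incl
  mfderiv_incl : ∀ v : V, (mfderiv 𝓘(ℝ, V) G.model incl 0 v : G.LieAlg) = split.symm (0, v)
  /-- the projection `π : G → H` -/
  proj : G →* H
  proj_smooth : ContMDiff G.model H.model ∞ proj
  mfderiv_proj : ∀ X : G.LieAlg, (mfderiv G.model H.model proj 1 X : H.LieAlg) = (split X).1
  incl_injective : Function.Injective incl
  exact : ∀ g : G, proj g = 1 ↔ ∃ v, incl v = g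
  proj_surjective : Function.Surjective proj

end

/-!
Let `k ∈ V₁`. As `F` lifts a map of the base, `F (g k) = F g * φ_k g` with `φ_k` taking values in
`V₂`, and `φ_k` is `β`-Hölder since `V₁` and `V₂` are central. Equality of the ranks means that `V₂`
meets the first layer of `𝔤₂` trivially. Smooth functions whose differential at the identity kills
the first layer are bounded near the identity by the square of the distance to it, so
`|v| ≲ d(1, v)²` for small `v ∈ V₂`. Along a curve of length `ℓ` cut into `n` arcs of comparable
length, `φ_k` therefore varies by at most `≲ n (ℓ / n) ^ (2 β)`, which tends to `0` as
`2 β > 1`: the map `φ_k` is constant along horizontal curves. By Chow's theorem these connect nearby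
points, so `φ_k` is constant on the connected open set `π₁⁻¹(U₁)`. The constant is additive and
continuous in `k`, hence linear.
-/

open Filter Topology

noncomputable section

universe u v w

/-! ### The bracket of a local Lie group -/

section PartialDerivatives

variable {E F W : Type*} [NormedAddCommGroup E] [NormedSpace ℝ E] [NormedAddCommGroup F]
  [NormedSpace ℝ F] [NormedAddCommGroup W] [NormedSpace ℝ W]

/-- The mixed second derivative `∂₁∂₂ M` of `M : E × F → W` at `p`. -/
def mixedFDeriv (M : E × F → W) (p : E × F) : E →L[ℝ] F →L[ℝ] W :=
  (ContinuousLinearMap.compL ℝ F (E × F) W).flip (.inr ℝ E F) ∘L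
    fderiv ℝ (fderiv ℝ M) p ∘L .inl ℝ E F

theorem fderiv_comp_prodMk_right {M : E × F → W} {x : E} {y : F}
    (hM : DifferentiableAt ℝ M (x, y)) :
    fderiv ℝ (fun y => M (x, y)) y = fderiv ℝ M (x, y) ∘L .inr ℝ E F :=
  (hM.hasFDerivAt.comp y (hasFDerivAt_prodMk_right x y)).fderiv

theorem fderiv_comp_prodMk_left {M : E × F → W} {x : E} {y : F}
    (hM : DifferentiableAt ℝ M (x, y)) :
    fderiv ℝ (fun x => M (x, y)) x = fderiv ℝ M (x, y) ∘L .inl ℝ E F :=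
  (hM.hasFDerivAt.comp x (hasFDerivAt_prodMk_left x y)).fderiv

theorem eventually_differentiableAt {f : E → W} {x : E} {n : WithTop ℕ∞} (hf : ContDiffAt ℝ n f x)
    (hn : 1 ≤ n) : ∀ᶠ y in 𝓝 x, DifferentiableAt ℝ f y :=
  ((hf.of_le hn).eventually (by simp)).mono fun _ hy => hy.differentiableAt one_ne_zero

theorem hasFDerivAt_fderiv_right {M : E × F → W} {x : E} {y : F}
    (hM : ContDiffAt ℝ 2 M (x, y)) :
    HasFDerivAt (fun x => fderiv ℝ (fun y => M (x, y)) y) (mixedFDeriv M (x, y)) x := by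
  have hcont : Tendsto (fun x' : E => (x', y)) (𝓝 x) (𝓝 (x, y)) :=
    (Continuous.prodMk_left y).tendsto x
  have hM' : HasFDerivAt (fderiv ℝ M) (fderiv ℝ (fderiv ℝ M) (x, y)) (x, y) :=
    ((hM.fderiv_right (m := 1) (by norm_num)).differentiableAt (by simp)).hasFDerivAt
  refine (((ContinuousLinearMap.compL ℝ F (E × F) W).flip (.inr ℝ E F)).hasFDerivAt.comp x
    (hM'.comp x (hasFDerivAt_prodMk_left x y))).congr_of_eventuallyEq ?_
  exact (hcont.eventually (eventually_differentiableAt hM one_le_two)).mono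
    fun x' hx' => fderiv_comp_prodMk_right hx'

theorem hasFDerivAt_fderiv_left {M : E × F → W} {x : E} {y : F}
    (hM : ContDiffAt ℝ 2 M (x, y)) :
    HasFDerivAt (fun y => fderiv ℝ (fun x => M (x, y)) x) (mixedFDeriv M (x, y)).flip y := by
  have hcont : Tendsto (fun y' : F => (x, y')) (𝓝 y) (𝓝 (x, y)) :=
    (Continuous.prodMk_right x).tendsto y
  have hM' : HasFDerivAt (fderiv ℝ M) (fderiv ℝ (fderiv ℝ M) (x, y)) (x, y) :=
    ((hM.fderiv_right (m := 1) (by norm_num)).differentiableAt (by simp)).hasFDerivAt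
  have hsymm : (mixedFDeriv M (x, y)).flip =
      (ContinuousLinearMap.compL ℝ E (E × F) W).flip (.inl ℝ E F) ∘L
        fderiv ℝ (fderiv ℝ M) (x, y) ∘L .inr ℝ E F := by
    ext v u
    exact (hM.isSymmSndFDerivAt (by simp)).eq (u, 0) (0, v)
  rw [hsymm]
  refine (((ContinuousLinearMap.compL ℝ E (E × F) W).flip (.inl ℝ E F)).hasFDerivAt.comp y
    (hM'.comp y (hasFDerivAt_prodMk_right x y))).congr_of_eventuallyEq ?_
  exact (hcont.eventually (eventually_differentiableAt hM one_le_two)).mono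
    fun y' hy' => fderiv_comp_prodMk_left hy'

end PartialDerivatives

section LocalGroup

variable {E : Type*} [NormedAddCommGroup E] [NormedSpace ℝ E]

/-- A local Lie group structure in coordinates: germs at the unit `e` of a product `mul` and of
the conjugation `conj (x, y) = x y x⁻¹`, with only the identities that the computation of `d Ad`
requires. -/
structure IsLocalGroup (mul conj : E × E → E) (e : E) : Prop where
  contDiffAt_mul : ContDiffAt ℝ 2 mul (e, e)
  contDiffAt_conj : ContDiffAt ℝ 2 conj (e, e)
  mul_unit : ∀ᶠ x in 𝓝 e, mul (x, e) = x
  unit_mul : ∀ᶠ y in 𝓝 e, mul (e, y) = y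
  unit_conj : ∀ᶠ y in 𝓝 e, conj (e, y) = y
  conj_unit : ∀ᶠ x in 𝓝 e, conj (x, e) = e
  conj_mul : ∀ᶠ p : E × E in 𝓝 (e, e), mul (conj p, p.1) = mul p

namespace IsLocalGroup

variable {mul conj : E × E → E} {e : E}

theorem fderiv_mul_left (h : IsLocalGroup mul conj e) :
    fderiv ℝ (fun x => mul (x, e)) e = .id ℝ E := by
  have hid : (fun x => mul (x, e)) =ᶠ[𝓝 e] id := h.mul_unit
  rw [hid.fderiv_eq, fderiv_id]

theorem fderiv_mul_right (h : IsLocalGroup mul conj e) :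
    fderiv ℝ (fun y => mul (e, y)) e = .id ℝ E := by
  have hid : (fun y => mul (e, y)) =ᶠ[𝓝 e] id := h.unit_mul
  rw [hid.fderiv_eq, fderiv_id]

theorem fderiv_conj_right (h : IsLocalGroup mul conj e) :
    fderiv ℝ (fun y => conj (e, y)) e = .id ℝ E := by
  have hid : (fun y => conj (e, y)) =ᶠ[𝓝 e] id := h.unit_conj
  rw [hid.fderiv_eq, fderiv_id]

/-- The derivative of `(x y x⁻¹) x = x y` with respect to `y`. -/
theorem fderiv_mul_comp_fderiv_conj (h : IsLocalGroup mul conj e) : ∀ᶠ x in 𝓝 e,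
    fderiv ℝ (fun z => mul (z, x)) e ∘L fderiv ℝ (fun y => conj (x, y)) e =
      fderiv ℝ (fun y => mul (x, y)) e := by
  have hl : Tendsto (fun x : E => (x, e)) (𝓝 e) (𝓝 (e, e)) :=
    (Continuous.prodMk_left e).tendsto e
  have hr : Tendsto (fun x : E => (e, x)) (𝓝 e) (𝓝 (e, e)) :=
    (Continuous.prodMk_right e).tendsto e
  filter_upwards [hl.eventually h.conj_mul.eventually_nhds, h.conj_unit,
    hr.eventually (eventually_differentiableAt h.contDiffAt_mul one_le_two),
    hl.eventually (eventually_differentiableAt h.contDiffAt_conj one_le_two)]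
    with x hx hxe dM dC
  have hconj : HasFDerivAt (fun y => conj (x, y)) (fderiv ℝ (fun y => conj (x, y)) e) e :=
    (dC.comp e (hasFDerivAt_prodMk_right x e).differentiableAt).hasFDerivAt
  have hmul : HasFDerivAt (fun z => mul (z, x)) (fderiv ℝ (fun z => mul (z, x)) e)
      (conj (x, e)) := by
    rw [hxe]
    exact (dM.comp e (hasFDerivAt_prodMk_left e x).differentiableAt).hasFDerivAt
  have heq : (fun y => mul (conj (x, y), x)) =ᶠ[𝓝 e] fun y => mul (x, y) :=
    ((Continuous.prodMk_right x).tendsto e).eventually hx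
  rw [← heq.fderiv_eq]
  exact (hmul.comp e hconj).fderiv.symm

/-- With `l = ∂₂ mul (·, e)`, `r = ∂₁ mul (e, ·)` and `a = ∂₂ conj (·, e)`, the identity `r a = l`
gives `a' = l' - r'` at `e`, and `l'`, `r'` are the two mixed second derivatives of `mul`. -/
theorem mixedFDeriv_conj (h : IsLocalGroup mul conj e) :
    mixedFDeriv conj (e, e) = mixedFDeriv mul (e, e) - (mixedFDeriv mul (e, e)).flip := by
  have hprod := (hasFDerivAt_fderiv_left h.contDiffAt_mul).clm_comp
    (hasFDerivAt_fderiv_right h.contDiffAt_conj)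
  have hl := hprod.unique ((hasFDerivAt_fderiv_right h.contDiffAt_mul).congr_of_eventuallyEq
    h.fderiv_mul_comp_fderiv_conj)
  rw [h.fderiv_mul_left, h.fderiv_conj_right] at hl
  rw [eq_sub_iff_add_eq]
  refine Eq.trans ?_ hl
  ext Y Z
  simp

end IsLocalGroup

end LocalGroup

/-! ### The adjoint action of a Lie group -/

section LieGroup

section Composition

variable {E E' E'' : Type*} [NormedAddCommGroup E] [NormedSpace ℝ E] [NormedAddCommGroup E']
  [NormedSpace ℝ E'] [NormedAddCommGroup E''] [NormedSpace ℝ E'']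
  {M M' M'' : Type*} [TopologicalSpace M] [ChartedSpace E M] [TopologicalSpace M']
  [ChartedSpace E' M'] [TopologicalSpace M''] [ChartedSpace E'' M'']

theorem hasMFDerivAt_comp_of_eq {g : M' → M''} {f : M → M'} {x : M} {y : M'} {L' : E' →L[ℝ] E''}
    {L : E →L[ℝ] E'} (hg : HasMFDerivAt 𝓘(ℝ, E') 𝓘(ℝ, E'') g y L')
    (hf : HasMFDerivAt 𝓘(ℝ, E) 𝓘(ℝ, E') f x L) (hy : f x = y) :
    HasMFDerivAt 𝓘(ℝ, E) 𝓘(ℝ, E'') (fun z => g (f z)) x (L' ∘L L) := by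
  subst hy
  exact HasMFDerivAt.comp x hg hf

end Composition

variable {E : Type*} [NormedAddCommGroup E] [NormedSpace ℝ E]
  {G : Type*} [TopologicalSpace G] [ChartedSpace E G] [Group G]

section Chart

variable (E G) in
/-- The preferred chart of a Lie group at the identity, the coordinate system in which all germs at
the identity are written. -/
def chartOne : PartialEquiv G E := extChartAt 𝓘(ℝ, E) (1 : G)

variable (E G) in
/-- The coordinates of the identity in the preferred chart. -/
def coordOne : E := chartOne E G 1

theorem one_mem_chartOne_source : (1 : G) ∈ (chartOne E G).source :=
  mem_extChartAt_source (I := 𝓘(ℝ, E)) (1 : G)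

@[simp] theorem chartOne_one : chartOne E G 1 = coordOne E G := rfl

@[simp] theorem chartOne_symm_coordOne : (chartOne E G).symm (coordOne E G) = 1 :=
  (chartOne E G).left_inv one_mem_chartOne_source

theorem chartOne_target_mem_nhds : (chartOne E G).target ∈ 𝓝 (coordOne E G) :=
  extChartAt_target_mem_nhds (I := 𝓘(ℝ, E)) (1 : G)

theorem chartOne_source_mem_nhds : (chartOne E G).source ∈ 𝓝 (1 : G) :=
  extChartAt_source_mem_nhds (I := 𝓘(ℝ, E)) (1 : G)

theorem tendsto_chartOne : Tendsto (chartOne E G) (𝓝 1) (𝓝 (coordOne E G)) :=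
  continuousAt_extChartAt (I := 𝓘(ℝ, E)) (1 : G)

theorem tendsto_chartOne_symm : Tendsto (chartOne E G).symm (𝓝 (coordOne E G)) (𝓝 1) := by
  have := (continuousAt_extChartAt_symm (I := 𝓘(ℝ, E)) (1 : G)).tendsto
  rwa [extChartAt_to_inv] at this

theorem hasMFDerivAt_one_iff {E' : Type*} [NormedAddCommGroup E'] [NormedSpace ℝ E']
    {f : G → E'} {L : E →L[ℝ] E'} : HasMFDerivAt 𝓘(ℝ, E) 𝓘(ℝ, E') f 1 L ↔
      ContinuousAt f 1 ∧
        HasFDerivAt (fun y => f ((chartOne E G).symm y)) L (coordOne E G) := by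
  simp only [HasMFDerivAt, writtenInExtChartAt, modelWithCornersSelf_coe, range_id]
  exact and_congr_right fun _ => hasFDerivWithinAt_univ

theorem hasMFDerivAt_one_of_chart {E' : Type*} [NormedAddCommGroup E'] [NormedSpace ℝ E']
    {f : G → E'} {L : E →L[ℝ] E'}
    (hf : HasFDerivAt (fun y => f ((chartOne E G).symm y)) L (coordOne E G)) :
    HasMFDerivAt 𝓘(ℝ, E) 𝓘(ℝ, E') f 1 L := by
  refine hasMFDerivAt_one_iff.2 ⟨?_, hf⟩
  have hcont : ContinuousAt ((fun y => f ((chartOne E G).symm y)) ∘ chartOne E G) 1 :=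
    ContinuousAt.comp (by exact hf.continuousAt) tendsto_chartOne
  refine hcont.congr ?_
  filter_upwards [chartOne_source_mem_nhds (E := E) (G := G)] with g hg
  simp [(chartOne E G).left_inv hg]

theorem hasMFDerivAt_chartOne :
    HasMFDerivAt 𝓘(ℝ, E) 𝓘(ℝ, E) (chartOne E G) 1 (.id ℝ E) := by
  refine hasMFDerivAt_one_of_chart ((hasFDerivAt_id _).congr_of_eventuallyEq ?_)
  filter_upwards [chartOne_target_mem_nhds (E := E) (G := G)] with y hy
  exact (chartOne E G).right_inv hy

/-- A vector field on a Lie group, read as a function in the preferred chart at the identity. -/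
def chartField (V : Π g : G, TangentSpace 𝓘(ℝ, E) g) : E → E :=
  VectorField.mpullbackWithin 𝓘(ℝ, E) 𝓘(ℝ, E) (chartOne E G).symm V (range 𝓘(ℝ, E))

theorem mlieBracket_one_eq_lieBracket_chartField [CompleteSpace E]
    (V W : Π g : G, TangentSpace 𝓘(ℝ, E) g) :
    (VectorField.mlieBracket 𝓘(ℝ, E) V W (1 : G) : E) =
      VectorField.lieBracket ℝ (chartField V) (chartField W) (coordOne E G) := by
  have hinv : ∀ L : E →L[ℝ] E, HasMFDerivAt 𝓘(ℝ, E) 𝓘(ℝ, E) (chartOne E G) 1 L →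
      (VectorField.mlieBracket 𝓘(ℝ, E) V W (1 : G) : E) = L.inverse
        (VectorField.lieBracketWithin ℝ (chartField V) (chartField W)
          ((chartOne E G).symm ⁻¹' univ ∩ range 𝓘(ℝ, E)) (coordOne E G)) := by
    rintro L hL
    obtain rfl := hL.mfderiv
    rw [← VectorField.mlieBracketWithin_univ]
    exact VectorField.mlieBracketWithin_apply
  rw [hinv _ hasMFDerivAt_chartOne, ContinuousLinearMap.inverse_id, preimage_univ, univ_inter,
    modelWithCornersSelf_coe, range_id, VectorField.lieBracketWithin_univ,
    ContinuousLinearMap.id_apply]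

end Chart

variable [LieGroup 𝓘(ℝ, E) ∞ G]

section Adjoint

theorem contMDiff_conj (g : G) : ContMDiff 𝓘(ℝ, E) 𝓘(ℝ, E) ∞ (fun y : G => g * y * g⁻¹) :=
  (contMDiff_mul_right (a := g⁻¹)).comp (contMDiff_mul_left (a := g))

variable (E) in
/-- The adjoint action `Ad g` of a Lie group on its Lie algebra, which is identified with the model
space. -/
def adj (g : G) : E →L[ℝ] E := mfderiv 𝓘(ℝ, E) 𝓘(ℝ, E) (fun y : G => g * y * g⁻¹) 1

theorem hasMFDerivAt_conj (g : G) :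
    HasMFDerivAt 𝓘(ℝ, E) 𝓘(ℝ, E) (fun y : G => g * y * g⁻¹) 1 (adj E g) :=
  ((contMDiff_conj g).mdifferentiable (by simp)).mdifferentiableAt.hasMFDerivAt

theorem adj_one : adj E (1 : G) = .id ℝ E := by
  have hid : (fun y : G => (1 : G) * y * (1 : G)⁻¹) = id := by ext; simp
  have hconj := hasMFDerivAt_conj (E := E) (1 : G)
  rw [hid] at hconj
  exact hasMFDerivAt_unique hconj (hasMFDerivAt_id 1)

theorem adj_mul (g h : G) : adj E (g * h) = adj E g ∘L adj E h := by
  have hcomp := hasMFDerivAt_comp_of_eq (hasMFDerivAt_conj (E := E) g)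
    (hasMFDerivAt_conj (E := E) h) (by simp)
  have hconj : (fun y : G => g * (h * y * h⁻¹) * g⁻¹) = fun y => g * h * y * (g * h)⁻¹ := by
    ext y; simp only [mul_inv_rev, mul_assoc]
  rw [hconj] at hcomp
  exact hasMFDerivAt_unique (hasMFDerivAt_conj (E := E) (g * h)) hcomp

end Adjoint

section LocalGroup

theorem contMDiffAt_chartOne_symm :
    ContMDiffAt 𝓘(ℝ, E) 𝓘(ℝ, E) ∞ (chartOne E G).symm (coordOne E G) :=
  (contMDiffOn_extChartAt_symm (1 : G)).contMDiffAt chartOne_target_mem_nhds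

theorem contDiffAt_chartOne_comp {Φ : G × G → G}
    (hΦ : ContMDiff (𝓘(ℝ, E).prod 𝓘(ℝ, E)) 𝓘(ℝ, E) ∞ Φ) (h1 : Φ (1, 1) = 1) :
    ContDiffAt ℝ ∞ (fun p : E × E => chartOne E G
      (Φ ((chartOne E G).symm p.1, (chartOne E G).symm p.2))) (coordOne E G, coordOne E G) := by
  rw [← contMDiffAt_iff_contDiffAt]
  have hfst : ContMDiffAt 𝓘(ℝ, E × E) 𝓘(ℝ, E) ∞ (fun p : E × E => (chartOne E G).symm p.1)
      (coordOne E G, coordOne E G) :=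
    contMDiffAt_chartOne_symm.comp_of_eq contDiffAt_fst.contMDiffAt rfl
  have hsnd : ContMDiffAt 𝓘(ℝ, E × E) 𝓘(ℝ, E) ∞ (fun p : E × E => (chartOne E G).symm p.2)
      (coordOne E G, coordOne E G) :=
    contMDiffAt_chartOne_symm.comp_of_eq contDiffAt_snd.contMDiffAt rfl
  have hchart : ContMDiffAt 𝓘(ℝ, E) 𝓘(ℝ, E) ∞ (chartOne E G) 1 := contMDiffAt_extChartAt
  exact hchart.comp_of_eq (hΦ.contMDiffAt.comp _ (hfst.prodMk hsnd)) (by simp [h1])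

variable (E G) in
/-- The group law in the preferred chart at the identity. -/
def chartMul (p : E × E) : E :=
  chartOne E G ((chartOne E G).symm p.1 * (chartOne E G).symm p.2)

variable (E G) in
/-- The conjugation `(x, y) ↦ x y x⁻¹` in the preferred chart at the identity. -/
def chartConj (p : E × E) : E :=
  chartOne E G ((chartOne E G).symm p.1 * (chartOne E G).symm p.2 * ((chartOne E G).symm p.1)⁻¹)

theorem contDiffAt_chartMul :
    ContDiffAt ℝ ∞ (chartMul E G) (coordOne E G, coordOne E G) :=
  contDiffAt_chartOne_comp (Φ := fun p => p.1 * p.2) (contMDiff_mul 𝓘(ℝ, E) ∞) (mul_one 1)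

theorem contDiffAt_chartConj :
    ContDiffAt ℝ ∞ (chartConj E G) (coordOne E G, coordOne E G) :=
  contDiffAt_chartOne_comp (Φ := fun p => p.1 * p.2 * p.1⁻¹)
    ((contMDiff_fst.mul contMDiff_snd).mul contMDiff_fst.inv) (by simp)

theorem tendsto_conj_chartOne_symm :
    Tendsto (fun p : E × E => (chartOne E G).symm p.1 * (chartOne E G).symm p.2 *
      ((chartOne E G).symm p.1)⁻¹) (𝓝 (coordOne E G, coordOne E G)) (𝓝 1) := by
  have : IsTopologicalGroup G := topologicalGroup_of_lieGroup 𝓘(ℝ, E) ∞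
  have hfst : Tendsto (fun p : E × E => (chartOne E G).symm p.1)
      (𝓝 (coordOne E G, coordOne E G)) (𝓝 1) :=
    tendsto_chartOne_symm.comp (continuous_fst.tendsto (coordOne E G, coordOne E G))
  have hsnd : Tendsto (fun p : E × E => (chartOne E G).symm p.2)
      (𝓝 (coordOne E G, coordOne E G)) (𝓝 1) :=
    tendsto_chartOne_symm.comp (continuous_snd.tendsto (coordOne E G, coordOne E G))
  simpa using (hfst.mul hsnd).mul hfst.inv

variable (E G) in
theorem isLocalGroup_chart : IsLocalGroup (chartMul E G) (chartConj E G) (coordOne E G) where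
  contDiffAt_mul := contDiffAt_chartMul.of_le ENat.LEInfty.out
  contDiffAt_conj := contDiffAt_chartConj.of_le ENat.LEInfty.out
  mul_unit := by
    filter_upwards [chartOne_target_mem_nhds (E := E) (G := G)] with x hx
    simp [chartMul, (chartOne E G).right_inv hx]
  unit_mul := by
    filter_upwards [chartOne_target_mem_nhds (E := E) (G := G)] with x hx
    simp [chartMul, (chartOne E G).right_inv hx]
  unit_conj := by
    filter_upwards [chartOne_target_mem_nhds (E := E) (G := G)] with x hx
    simp [chartConj, (chartOne E G).right_inv hx]
  conj_unit := by simp [chartConj]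
  conj_mul := by
    filter_upwards [tendsto_conj_chartOne_symm (chartOne_source_mem_nhds (E := E) (G := G))]
      with p hp
    rw [chartMul, chartConj, (chartOne E G).left_inv hp, inv_mul_cancel_right, chartMul]

end LocalGroup

section Bracket

theorem chartField_mulInvariantVectorField [CompleteSpace E] (Z : E) :
    chartField (mulInvariantVectorField (I := 𝓘(ℝ, E)) (G := G) Z) =ᶠ[𝓝 (coordOne E G)]
      fun x => fderiv ℝ (fun y => chartMul E G (x, y)) (coordOne E G) Z := by
  have : IsManifold 𝓘(ℝ, E) 1 G := IsManifold.of_le (n := ∞) (by norm_num)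
  filter_upwards [chartOne_target_mem_nhds (E := E) (G := G)] with x hx
  set g := (chartOne E G).symm x
  have hg : g ∈ (chartOne E G).source := (chartOne E G).map_target hx
  have hmul : HasMFDerivAt 𝓘(ℝ, E) 𝓘(ℝ, E) (fun y : G => g * y) 1
      (mfderiv 𝓘(ℝ, E) 𝓘(ℝ, E) (fun y : G => g * y) 1) :=
    ((contMDiff_mul_left (n := ∞)).mdifferentiable (by simp) 1).hasMFDerivAt
  have hchart : HasMFDerivAt 𝓘(ℝ, E) 𝓘(ℝ, E) (chartOne E G) g
      (mfderiv 𝓘(ℝ, E) 𝓘(ℝ, E) (chartOne E G) g) :=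
    (mdifferentiableAt_extChartAt (by simpa [chartOne] using hg)).hasMFDerivAt
  have hcomp := (hasMFDerivAt_one_iff.1 (hasMFDerivAt_comp_of_eq hchart hmul (mul_one g))).2.fderiv
  rw [chartField,
    VectorField.mpullbackWithin_apply, chartOne, ContinuousLinearMap.inverse_eq
    (mfderivWithin_extChartAt_symm_comp_mfderiv_extChartAt (I := 𝓘(ℝ, E)) hx)
    (mfderiv_extChartAt_comp_mfderivWithin_extChartAt_symm (I := 𝓘(ℝ, E)) hx)]
  exact (congrArg (fun L : E →L[ℝ] E => L Z) hcomp).symm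

theorem lieBracket_chartField_mulInvariantVectorField [CompleteSpace E] (Y Z : E) :
    VectorField.lieBracket ℝ
        (chartField (mulInvariantVectorField (I := 𝓘(ℝ, E)) (G := G) Y))
        (chartField (mulInvariantVectorField (I := 𝓘(ℝ, E)) (G := G) Z)) (coordOne E G) =
      mixedFDeriv (chartMul E G) (coordOne E G, coordOne E G) Y Z -
        mixedFDeriv (chartMul E G) (coordOne E G, coordOne E G) Z Y := by
  have hchart := isLocalGroup_chart E G
  have hfield (X : E) := chartField_mulInvariantVectorField (G := G) X
  have hfield_one (X : E) := (hfield X).self_of_nhds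
  have hmixed (X : E) : fderiv ℝ (fun x => fderiv ℝ (fun y => chartMul E G (x, y))
      (coordOne E G) X) (coordOne E G) = _ :=
    ((ContinuousLinearMap.apply ℝ E X).hasFDerivAt.comp (coordOne E G)
      (hasFDerivAt_fderiv_right hchart.contDiffAt_mul)).fderiv
  simp only [hchart.fderiv_mul_right, ContinuousLinearMap.id_apply] at hfield_one
  rw [VectorField.lieBracket, (hfield Y).fderiv_eq, (hfield Z).fderiv_eq, hfield_one, hfield_one,
    hmixed, hmixed]
  rfl

variable (E G) in
/-- The Lie bracket as a continuous bilinear map on the model space. -/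
def lieBracketL : E →L[ℝ] E →L[ℝ] E :=
  mixedFDeriv (chartConj E G) (coordOne E G, coordOne E G)

theorem lieBracketL_apply [CompleteSpace E] (Y Z : GroupLieAlgebra 𝓘(ℝ, E) G) :
    lieBracketL E G Y Z = (⁅Y, Z⁆ : GroupLieAlgebra 𝓘(ℝ, E) G) := by
  have hconj := (isLocalGroup_chart E G).mixedFDeriv_conj
  have hbracket := lieBracket_chartField_mulInvariantVectorField (E := E) (G := G) Y Z
  rw [← mlieBracket_one_eq_lieBracket_chartField] at hbracket
  exact (congrArg (fun L : E →L[ℝ] E →L[ℝ] E => L Y Z) hconj).trans hbracket.symm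

theorem adj_eq_fderiv (g : G) : adj E g =
    fderiv ℝ (fun y => chartOne E G (g * (chartOne E G).symm y * g⁻¹)) (coordOne E G) :=
  (hasMFDerivAt_one_iff.1 (hasMFDerivAt_comp_of_eq hasMFDerivAt_chartOne
    (hasMFDerivAt_conj (E := E) g) (by simp))).2.fderiv.symm

theorem hasMFDerivAt_adj_one :
    HasMFDerivAt 𝓘(ℝ, E) 𝓘(ℝ, E →L[ℝ] E) (fun g : G => adj E g) 1 (lieBracketL E G) := by
  refine hasMFDerivAt_one_of_chart ?_
  simp only [adj_eq_fderiv]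
  exact hasFDerivAt_fderiv_right (isLocalGroup_chart E G).contDiffAt_conj

end Bracket

end LieGroup

/-! ### Curves and the sub-Riemannian distance -/

section LeftDerivative

variable {E : Type*} [NormedAddCommGroup E] [NormedSpace ℝ E]
  {G : Type*} [TopologicalSpace G] [ChartedSpace E G] [Group G] [LieGroup 𝓘(ℝ, E) ∞ G]

variable (E) in
/-- The left-trivialized differential `X ↦ dφ_g((L_g)_* X)` of a real function `φ` on a Lie group,
used to differentiate `φ` along curves with prescribed left-trivialized velocity. -/
def leftDiff (φ : G → ℝ) (g : G) : E →L[ℝ] ℝ :=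
  mfderiv 𝓘(ℝ, E) 𝓘(ℝ, ℝ) (fun y : G => φ (g * y)) 1

theorem hasMFDerivAt_leftDiff {φ : G → ℝ} (hφ : ContMDiff 𝓘(ℝ, E) 𝓘(ℝ, ℝ) ∞ φ) (g : G) :
    HasMFDerivAt 𝓘(ℝ, E) 𝓘(ℝ, ℝ) (fun y : G => φ (g * y)) 1 (leftDiff E φ g) :=
  ((hφ.comp (contMDiff_mul_left (a := g))).mdifferentiable (by simp)).mdifferentiableAt.hasMFDerivAt

theorem leftDiff_apply_eq_mfderiv_mul {φ : G → ℝ} (hφ : ContMDiff 𝓘(ℝ, E) 𝓘(ℝ, ℝ) ∞ φ) (g : G)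
    (X : E) : leftDiff E φ g X = (mfderiv (𝓘(ℝ, E).prod 𝓘(ℝ, E)) 𝓘(ℝ, ℝ)
      (fun p : G × G => φ (p.1 * p.2)) (g, 1) : E × E →L[ℝ] ℝ) (0, X) := by
  have hmul : ContMDiff (𝓘(ℝ, E).prod 𝓘(ℝ, E)) 𝓘(ℝ, ℝ) ∞ fun p : G × G => φ (p.1 * p.2) :=
    hφ.comp (contMDiff_mul 𝓘(ℝ, E) ∞)
  have hadd := mfderiv_prod_eq_add_apply (I := 𝓘(ℝ, E)) (I' := 𝓘(ℝ, E)) (p := (g, (1 : G)))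
    (v := ((0 : E), X)) (hmul.mdifferentiableAt (by simp))
  have hzero : (mfderiv 𝓘(ℝ, E) 𝓘(ℝ, ℝ) (fun z : G => φ (z * 1)) g : E →L[ℝ] ℝ) 0 = 0 := map_zero _
  refine Eq.trans ?_ (hadd.trans (congrArg (fun r : ℝ => r + leftDiff E φ g X) hzero)).symm
  exact (zero_add _).symm

open Bundle in
theorem contMDiff_leftDiff {φ : G → ℝ} (hφ : ContMDiff 𝓘(ℝ, E) 𝓘(ℝ, ℝ) ∞ φ) (X : E) :
    ContMDiff 𝓘(ℝ, E) 𝓘(ℝ, ℝ) ∞ (fun g => leftDiff E φ g X) := by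
  have hmul : ContMDiff (𝓘(ℝ, E).prod 𝓘(ℝ, E)) 𝓘(ℝ, ℝ) ∞ fun p : G × G => φ (p.1 * p.2) :=
    hφ.comp (contMDiff_mul 𝓘(ℝ, E) ∞)
  have hzero : ContMDiff 𝓘(ℝ, E) 𝓘(ℝ, E).tangent ∞
      fun g : G => (TotalSpace.mk' E g 0 : TangentBundle 𝓘(ℝ, E) G) := contMDiff_zeroSection _ _
  have hvec : ContMDiff 𝓘(ℝ, E) 𝓘(ℝ, E).tangent ∞
      fun _ : G => (TotalSpace.mk' E 1 X : TangentBundle 𝓘(ℝ, E) G) := contMDiff_const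
  have hsection := (contMDiff_equivTangentBundleProd_symm (I := 𝓘(ℝ, E)) (M := G)
    (I' := 𝓘(ℝ, E)) (M' := G) (n := ∞)).comp (hzero.prodMk hvec)
  have htangent := (hmul.contMDiff_tangentMap (m := ∞) (by simp)).comp hsection
  exact ((contMDiff_snd_tangentBundle_modelSpace ℝ 𝓘(ℝ, ℝ) (n := ∞)).comp htangent).congr
    fun g => leftDiff_apply_eq_mfderiv_mul hφ g X

theorem leftDiff_eq_zero_of_notMem_tsupport {φ : G → ℝ} {g : G} (hg : g ∉ tsupport φ) :
    leftDiff E φ g = 0 := by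
  have : IsTopologicalGroup G := topologicalGroup_of_lieGroup 𝓘(ℝ, E) ∞
  have htendsto : Tendsto (fun y : G => g * y) (𝓝 1) (𝓝 g) := by
    simpa using (continuous_const_mul g).tendsto (1 : G)
  have hzero : (fun y : G => φ (g * y)) =ᶠ[𝓝 1] fun _ => (0 : ℝ) :=
    htendsto.eventually (notMem_tsupport_iff_eventuallyEq.1 hg)
  rw [leftDiff, hzero.mfderiv_eq]
  exact mfderiv_const

theorem hasCompactSupport_leftDiff [T2Space G] {φ : G → ℝ} (hφ : HasCompactSupport φ) (X : E) :
    HasCompactSupport (fun g => leftDiff E φ g X) :=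
  hφ.mono' fun g hg => by
    by_contra hsupp
    exact hg (by simp [leftDiff_eq_zero_of_notMem_tsupport (E := E) hsupp])

end LeftDerivative

section AbsoluteContinuity

theorem absolutelyContinuousOnInterval_of_eq_integral {f g : ℝ → ℝ} {a b : ℝ}
    (hg : IntervalIntegrable g volume a b)
    (hf : ∀ x ∈ uIcc a b, f x = f a + ∫ t in a..x, g t) :
    AbsolutelyContinuousOnInterval f a b := by
  have hint := hg.absolutelyContinuousOnInterval_intervalIntegral (c := a) left_mem_uIcc
  rw [absolutelyContinuousOnInterval_iff] at hint ⊢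
  intro ε hε
  obtain ⟨δ, hδ, h⟩ := hint ε hε
  refine ⟨δ, hδ, fun E hE hs => ?_⟩
  convert h E hE hs using 2 with i hi
  rw [hf _ (hE.1 i hi).1, hf _ (hE.1 i hi).2, dist_add_left]

theorem absolutelyContinuousOnInterval_eq_integral {f : ℝ → ℝ} {a b : ℝ}
    (hf : AbsolutelyContinuousOnInterval f a b) {x : ℝ} (hx : x ∈ uIcc a b) :
    f x = f a + ∫ t in a..x, deriv f t := by
  rw [(hf.mono (uIcc_subset_uIcc_left hx)).integral_deriv_eq_sub, add_sub_cancel]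

theorem absolutelyContinuousOnInterval_congr {X : Type*} [PseudoMetricSpace X] {f g : ℝ → X}
    {a b : ℝ} (hf : AbsolutelyContinuousOnInterval f a b) (h : EqOn f g (uIcc a b)) :
    AbsolutelyContinuousOnInterval g a b := by
  rw [absolutelyContinuousOnInterval_iff] at hf ⊢
  intro ε hε
  obtain ⟨δ, hδ, hf⟩ := hf ε hε
  refine ⟨δ, hδ, fun E hE hs => ?_⟩
  convert hf E hE hs using 2 with i hi
  rw [h (hE.1 i hi).1, h (hE.1 i hi).2]

theorem absolutelyContinuousOnInterval_trans {f : ℝ → ℝ} {a b c : ℝ}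
    (hab : AbsolutelyContinuousOnInterval f a b) (hbc : AbsolutelyContinuousOnInterval f b c) :
    AbsolutelyContinuousOnInterval f a c := by
  have iab := hab.intervalIntegrable_deriv
  have ibc := hbc.intervalIntegrable_deriv
  refine absolutelyContinuousOnInterval_of_eq_integral (iab.trans ibc) fun x hx => ?_
  rcases uIcc_subset_uIcc_union_uIcc (b := b) hx with h | h
  · exact absolutelyContinuousOnInterval_eq_integral hab h
  · rw [← intervalIntegral.integral_add_adjacent_intervals iab
      (ibc.mono_set (uIcc_subset_uIcc_left h)), ← add_assoc,
      ← absolutelyContinuousOnInterval_eq_integral hab right_mem_uIcc]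
    exact absolutelyContinuousOnInterval_eq_integral hbc h

theorem absolutelyContinuousOnInterval_comp_affine {f : ℝ → ℝ} {a c x y : ℝ} (hc : c ≠ 0)
    (hf : AbsolutelyContinuousOnInterval f (a + c * x) (a + c * y)) :
    AbsolutelyContinuousOnInterval (fun t => f (a + c * t)) x y := by
  have hmaps : MapsTo (fun t => a + c * t) (uIcc x y) (uIcc (a + c * x) (a + c * y)) := by
    rcases le_total 0 c with h | h
    · exact Monotone.mapsTo_uIcc fun s t hst =>
        add_le_add_right (mul_le_mul_of_nonneg_left hst h) a
    · exact Antitone.mapsTo_uIcc fun s t hst =>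
        add_le_add_right (mul_le_mul_of_nonpos_left hst h) a
  refine absolutelyContinuousOnInterval_of_eq_integral (g := fun t => c * deriv f (a + c * t))
    (.const_mul ?_ _) fun t ht => ?_
  · simpa [hc] using (hf.intervalIntegrable_deriv.comp_add_left a).comp_mul_left (c := c)
  · rw [intervalIntegral.integral_const_mul, intervalIntegral.mul_integral_comp_add_mul]
    exact absolutelyContinuousOnInterval_eq_integral hf (hmaps ht)

end AbsoluteContinuity

section Affine

theorem hasMFDerivAt_affine (a c t : ℝ) : HasMFDerivAt 𝓘(ℝ, ℝ) 𝓘(ℝ, ℝ) (fun t : ℝ => a + c * t) t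
    (ContinuousLinearMap.toSpanSingleton ℝ c) := by
  have : HasDerivAt (fun t : ℝ => a + c * t) c t := by
    simpa using ((hasDerivAt_id t).const_mul c).const_add a
  exact this.hasFDerivAt.hasMFDerivAt

theorem image_affine_Icc_eq_uIcc (a b : ℝ) :
    (fun t => a + (b - a) * t) '' Icc (0 : ℝ) 1 = uIcc a b := by
  rw [← segment_eq_uIcc, segment_eq_image']
  simp only [smul_eq_mul, mul_comm]

theorem quasiMeasurePreserving_affine (a : ℝ) {c : ℝ} (hc : c ≠ 0) :
    Measure.QuasiMeasurePreserving (fun t : ℝ => a + c * t) volume volume :=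
  (measurePreserving_add_left volume a).quasiMeasurePreserving.comp
    (Measure.quasiMeasurePreserving_smul volume hc)

/-- The restriction of a curve to the interval between `a` and `b`, parametrized by `[0,1]`. -/
def affineRestrict {X : Type*} (γ : ℝ → X) (a b : ℝ) (t : ℝ) : X := γ (a + (b - a) * t)

/-- The concatenation of two curves parametrized by `[0,1]`. -/
def concat {X : Type*} (γ₁ γ₂ : ℝ → X) (t : ℝ) : X :=
  if t ≤ 1 / 2 then γ₁ (0 + 2 * t) else γ₂ (-1 + 2 * t)

variable {X : Type*} (γ₁ γ₂ : ℝ → X) {t : ℝ}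

theorem concat_of_le (ht : t ≤ 1 / 2) : concat γ₁ γ₂ t = γ₁ (0 + 2 * t) := if_pos ht

theorem concat_of_lt (ht : 1 / 2 < t) : concat γ₁ γ₂ t = γ₂ (-1 + 2 * t) := if_neg ht.not_ge

theorem concat_zero : concat γ₁ γ₂ 0 = γ₁ 0 := by simp [concat]

theorem concat_one : concat γ₁ γ₂ 1 = γ₂ 1 := by
  rw [concat_of_lt _ _ (by norm_num)]
  norm_num

end Affine

namespace CarnotGroup

/-- The model space of a Carnot group. -/
abbrev Coord (G : CarnotGroup.{u}) : Type := EuclideanSpace ℝ (Fin G.dim)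

variable {G : CarnotGroup.{u}}

instance : IsTopologicalGroup G := topologicalGroup_of_lieGroup G.model ∞

instance : LocallyCompactSpace G := ChartedSpace.locallyCompactSpace G.Coord G

theorem algNorm_smul (c : ℝ) (X : G.LieAlg) : G.algNorm (c • X) = |c| * G.algNorm X := by
  simp only [algNorm, map_smul, LinearMap.smul_apply, smul_eq_mul]
  rw [← mul_assoc, Real.sqrt_mul (mul_self_nonneg c), Real.sqrt_mul_self_eq_abs]

theorem algNorm_zero : G.algNorm 0 = 0 := by simp [algNorm]

section LeftDeriv

theorem mdifferentiable_const_mul (a : G) : MDifferentiable G.model G.model fun x : G => a * x :=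
  (contMDiff_mul_left (n := ∞)).mdifferentiable (by simp)

theorem mdifferentiableAt_const_mul_iff (a : G) {γ : ℝ → G} {t : ℝ} :
    MDifferentiableAt 𝓘(ℝ, ℝ) G.model (fun s => a * γ s) t ↔
      MDifferentiableAt 𝓘(ℝ, ℝ) G.model γ t := by
  refine ⟨fun h => ?_, fun h => (mdifferentiable_const_mul a _).comp t h⟩
  convert! (mdifferentiable_const_mul a⁻¹ (a * γ t)).comp t h using 1
  ext s
  simp

theorem mdifferentiableAt_comp_affine_iff (γ : ℝ → G) (a : ℝ) {c t : ℝ} (hc : c ≠ 0) :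
    MDifferentiableAt 𝓘(ℝ, ℝ) G.model (fun s => γ (a + c * s)) t ↔
      MDifferentiableAt 𝓘(ℝ, ℝ) G.model γ (a + c * t) := by
  refine ⟨fun h => ?_, fun h => h.comp t (hasMFDerivAt_affine a c t).mdifferentiableAt⟩
  have hinv : -a / c + c⁻¹ * (a + c * t) = t := by field_simp; ring
  rw [← hinv] at h
  convert! h.comp (a + c * t) (hasMFDerivAt_affine (-a / c) c⁻¹ _).mdifferentiableAt using 1
  ext s
  have hs : a + c * (-a / c + c⁻¹ * s) = s := by field_simp; ring
  simp [hs]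

theorem leftDeriv_eq_mfderiv (γ : ℝ → G) (t : ℝ) :
    G.leftDeriv γ t = (mfderiv 𝓘(ℝ, ℝ) G.model (fun s => (γ t)⁻¹ * γ s) t : ℝ →L[ℝ] G.Coord) 1 := by
  by_cases h : MDifferentiableAt 𝓘(ℝ, ℝ) G.model γ t
  · exact (congrArg (fun L : ℝ →L[ℝ] G.Coord => L 1)
      (mfderiv_comp t (mdifferentiable_const_mul _ _) h)).symm
  · rw [leftDeriv, mfderiv_zero_of_not_mdifferentiableAt h, mfderiv_zero_of_not_mdifferentiableAt
      (mt (mdifferentiableAt_const_mul_iff _).1 h)]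
    exact map_zero _

theorem leftDeriv_const_mul (a : G) (γ : ℝ → G) (t : ℝ) :
    G.leftDeriv (fun s => a * γ s) t = G.leftDeriv γ t := by
  have hinv : (fun s => (a * γ t)⁻¹ * (a * γ s)) = fun s => (γ t)⁻¹ * γ s := by ext s; group
  rw [leftDeriv_eq_mfderiv, leftDeriv_eq_mfderiv, hinv]
  rfl

theorem leftDeriv_congr {γ γ' : ℝ → G} {t : ℝ} (h : γ =ᶠ[𝓝 t] γ') :
    G.leftDeriv γ t = G.leftDeriv γ' t := by
  have : (fun s => (γ t)⁻¹ * γ s) =ᶠ[𝓝 t] fun s => (γ' t)⁻¹ * γ' s := by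
    filter_upwards [h] with s hs
    rw [hs, h.self_of_nhds]
  rw [leftDeriv_eq_mfderiv, leftDeriv_eq_mfderiv, this.mfderiv_eq]
  rfl

theorem leftDeriv_const (a : G) (t : ℝ) : G.leftDeriv (fun _ => a) t = 0 := by
  rw [leftDeriv_eq_mfderiv]
  exact congrArg (fun L : ℝ →L[ℝ] G.Coord => L 1) mfderiv_const

theorem leftDeriv_comp_affine (γ : ℝ → G) (a : ℝ) {c : ℝ} (hc : c ≠ 0) (t : ℝ) :
    G.leftDeriv (fun s => γ (a + c * s)) t = c • G.leftDeriv γ (a + c * t) := by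
  rw [leftDeriv_eq_mfderiv, leftDeriv_eq_mfderiv]
  set f : ℝ → G := fun s => (γ (a + c * t))⁻¹ * γ s
  by_cases h : MDifferentiableAt 𝓘(ℝ, ℝ) G.model f (a + c * t)
  · have hcomp := (hasMFDerivAt_comp_of_eq h.hasMFDerivAt (hasMFDerivAt_affine a c t) rfl).mfderiv
    refine (congrArg (fun L : ℝ →L[ℝ] G.Coord => L 1) hcomp).trans ?_
    have hsmul : ContinuousLinearMap.toSpanSingleton ℝ c (1 : ℝ) = c • (1 : ℝ) := by simp
    exact (congrArg (mfderiv 𝓘(ℝ, ℝ) G.model f (a + c * t) : ℝ →L[ℝ] G.Coord) hsmul).trans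
      (map_smul _ _ _)
  · rw [mfderiv_zero_of_not_mdifferentiableAt h, mfderiv_zero_of_not_mdifferentiableAt
      (mt (mdifferentiableAt_comp_affine_iff f a hc).1 h)]
    exact (smul_zero (A := G.Coord) c).symm

theorem hasDerivAt_comp_curve {φ : G → ℝ} (hφ : ContMDiff G.model 𝓘(ℝ, ℝ) ∞ φ) {γ : ℝ → G} {t : ℝ}
    (h : MDifferentiableAt 𝓘(ℝ, ℝ) G.model γ t) :
    HasDerivAt (fun s => φ (γ s)) (leftDiff G.Coord φ (γ t) (G.leftDeriv γ t)) t := by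
  have hcomp := hasMFDerivAt_comp_of_eq (hasMFDerivAt_leftDiff hφ (γ t))
    ((mdifferentiableAt_const_mul_iff (γ t)⁻¹).2 h).hasMFDerivAt (inv_mul_cancel (γ t))
  have hderiv : HasDerivAt _ _ t := HasFDerivAt.hasDerivAt (𝕜 := ℝ) (F := ℝ)
    (f' := leftDiff G.Coord φ (γ t) ∘L
      (mfderiv 𝓘(ℝ, ℝ) G.model (fun s => (γ t)⁻¹ * γ s) t : ℝ →L[ℝ] G.Coord))
    (hasMFDerivAt_iff_hasFDerivAt.1 hcomp)
  simp only [mul_inv_cancel_left] at hderiv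
  rw [leftDeriv_eq_mfderiv]
  exact hderiv

end LeftDeriv

section Length

/-- The length of a curve on a set of parameters. -/
def lengthOn (γ : ℝ → G) (s : Set ℝ) : ℝ≥0∞ :=
  ∫⁻ t in s, ENNReal.ofReal (G.algNorm (G.leftDeriv γ t))

theorem length_eq_lengthOn (γ : ℝ → G) : G.length γ = lengthOn γ (Icc 0 1) := rfl

theorem lengthOn_mono (γ : ℝ → G) {s s' : Set ℝ} (h : s ⊆ s') : lengthOn γ s ≤ lengthOn γ s' :=
  lintegral_mono_set h

theorem length_affineRestrict (γ : ℝ → G) {a b : ℝ} (hab : a ≠ b) :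
    G.length (affineRestrict γ a b) = lengthOn γ (uIcc a b) := by
  have hc : b - a ≠ 0 := sub_ne_zero.2 hab.symm
  rw [lengthOn, ← image_affine_Icc_eq_uIcc,
    lintegral_image_eq_lintegral_abs_deriv_mul measurableSet_Icc (f' := fun _ => b - a)
    (fun x _ => by simpa using (((hasDerivAt_id x).const_mul (b - a)).const_add a).hasDerivWithinAt)
    (fun x _ y _ h => by simpa [hc] using h)]
  refine lintegral_congr fun t => ?_
  rw [← ENNReal.ofReal_mul (abs_nonneg _), ← algNorm_smul, ← leftDeriv_comp_affine _ _ hc]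
  rfl

theorem length_congr {γ γ' : ℝ → G} (h : EqOn γ γ' (Ioo 0 1)) : G.length γ = G.length γ' := by
  simp only [length]
  rw [← setLIntegral_congr (Ioo_ae_eq_Icc (a := (0 : ℝ)) (b := 1)),
    ← setLIntegral_congr (Ioo_ae_eq_Icc (a := (0 : ℝ)) (b := 1))]
  refine setLIntegral_congr_fun measurableSet_Ioo fun t ht => ?_
  simp only [leftDeriv_congr (h.eventuallyEq_of_mem (isOpen_Ioo.mem_nhds ht))]

theorem length_const_mul (γ : ℝ → G) (a : G) : G.length (fun t => a * γ t) = G.length γ := by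
  simp only [length, leftDeriv_const_mul]

theorem length_const (a : G) : G.length (fun _ => a) = 0 := by
  simp [length, leftDeriv_const, algNorm_zero]

theorem length_concat_le (γ₁ γ₂ : ℝ → G) :
    G.length (concat γ₁ γ₂) ≤ G.length γ₁ + G.length γ₂ := by
  have hleft : G.length γ₁ = lengthOn (concat γ₁ γ₂) (uIcc 0 (1 / 2)) := by
    rw [← length_affineRestrict _ (by norm_num)]
    refine length_congr fun t ht => ?_
    rw [affineRestrict, concat_of_le _ _ (by linarith [ht.2])]
    ring_nf
  have hright : G.length γ₂ = lengthOn (concat γ₁ γ₂) (uIcc (1 / 2) 1) := by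
    rw [← length_affineRestrict _ (by norm_num)]
    refine length_congr fun t ht => ?_
    rw [affineRestrict, concat_of_lt _ _ (by linarith [ht.1])]
    ring_nf
  rw [hleft, hright, length_eq_lengthOn, uIcc_of_le (by norm_num), uIcc_of_le (by norm_num),
    ← Icc_union_Icc_eq_Icc (show (0 : ℝ) ≤ 1 / 2 by norm_num) (by norm_num)]
  exact lintegral_union_le _ _ _

end Length

section Horizontal

theorem isHorizontal_affineRestrict {γ : ℝ → G} (hγ : G.IsHorizontal γ) {a b : ℝ} (hab : a ≠ b)
    (ha : a ∈ Icc (0 : ℝ) 1) (hb : b ∈ Icc (0 : ℝ) 1) :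
    G.IsHorizontal (affineRestrict γ a b) := by
  have hc : b - a ≠ 0 := sub_ne_zero.2 hab.symm
  refine ⟨fun φ hφ => ?_, ?_⟩
  · refine absolutelyContinuousOnInterval_comp_affine (f := fun t => φ (γ t)) hc
      ((hγ.absolutelyContinuous φ hφ).mono (uIcc_subset_uIcc ?_ ?_)) <;> simpa
  · have hhor := hγ.horizontal
    rw [ae_restrict_iff' measurableSet_Icc] at hhor ⊢
    filter_upwards [(quasiMeasurePreserving_affine a hc).ae hhor] with t ht htmem
    have hmem : a + (b - a) * t ∈ Icc (0 : ℝ) 1 :=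
      uIcc_subset_Icc ha hb (image_affine_Icc_eq_uIcc a b ▸ mem_image_of_mem _ htmem)
    have hderiv : G.leftDeriv (affineRestrict γ a b) t = _ := leftDeriv_comp_affine γ a hc t
    exact hderiv ▸ Submodule.smul_mem _ _ (ht hmem)

theorem isHorizontal_const_mul {γ : ℝ → G} (hγ : G.IsHorizontal γ) (a : G) :
    G.IsHorizontal (fun t => a * γ t) :=
  ⟨fun φ hφ => hγ.absolutelyContinuous (fun y => φ (a * y)) (hφ.comp contMDiff_mul_left), by
    simpa only [leftDeriv_const_mul] using hγ.horizontal⟩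

theorem isHorizontal_const (a : G) : G.IsHorizontal (fun _ => a) :=
  ⟨fun φ _ => absolutelyContinuousOnInterval_of_eq_integral (g := fun _ => 0) (by simp) (by simp),
    by simp [leftDeriv_const]⟩

theorem isHorizontal_concat {γ₁ γ₂ : ℝ → G} (h₁ : G.IsHorizontal γ₁) (h₂ : G.IsHorizontal γ₂)
    (h : γ₁ 1 = γ₂ 0) : G.IsHorizontal (concat γ₁ γ₂) := by
  refine ⟨fun φ hφ => ?_, ?_⟩
  · have hleft : AbsolutelyContinuousOnInterval (fun t => φ (γ₁ (0 + 2 * t))) 0 (1 / 2) :=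
      absolutelyContinuousOnInterval_comp_affine (f := fun t => φ (γ₁ t)) two_ne_zero
        (by simpa using h₁.absolutelyContinuous φ hφ)
    have hright : AbsolutelyContinuousOnInterval (fun t => φ (γ₂ (-1 + 2 * t))) (1 / 2) 1 :=
      absolutelyContinuousOnInterval_comp_affine (f := fun t => φ (γ₂ t)) two_ne_zero
        (by norm_num; exact h₂.absolutelyContinuous φ hφ)
    refine absolutelyContinuousOnInterval_trans
      (absolutelyContinuousOnInterval_congr hleft fun t ht => ?_)
      (absolutelyContinuousOnInterval_congr hright fun t ht => ?_) <;>
      rw [uIcc_of_le (by norm_num)] at ht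
    · exact congrArg φ (concat_of_le γ₁ γ₂ ht.2).symm
    · rcases ht.1.eq_or_lt with rfl | ht'
      · simp [concat, h]
      · exact congrArg φ (concat_of_lt γ₁ γ₂ ht').symm
  · have hleft := h₁.horizontal
    have hright := h₂.horizontal
    rw [ae_restrict_iff' measurableSet_Icc] at hleft hright ⊢
    have hne : ∀ᵐ t : ℝ, t ≠ 1 / 2 := by simp [ae_iff, measure_singleton]
    filter_upwards [(quasiMeasurePreserving_affine 0 two_ne_zero).ae hleft,
      (quasiMeasurePreserving_affine (-1) two_ne_zero).ae hright, hne] with t htl htr htne ht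
    rcases lt_or_gt_of_ne htne with hlt | hgt
    · have hconcat : concat γ₁ γ₂ =ᶠ[𝓝 t] fun t => γ₁ (0 + 2 * t) := by
        filter_upwards [Iio_mem_nhds hlt] with s hs using concat_of_le γ₁ γ₂ (mem_Iio.1 hs).le
      rw [leftDeriv_congr hconcat, leftDeriv_comp_affine _ _ two_ne_zero]
      exact Submodule.smul_mem _ _ (htl ⟨by linarith [ht.1], by linarith⟩)
    · have hconcat : concat γ₁ γ₂ =ᶠ[𝓝 t] fun t => γ₂ (-1 + 2 * t) := by
        filter_upwards [Ioi_mem_nhds hgt] with s hs using concat_of_lt γ₁ γ₂ hs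
      rw [leftDeriv_congr hconcat, leftDeriv_comp_affine _ _ two_ne_zero]
      exact Submodule.smul_mem _ _ (htr ⟨by linarith, by linarith [ht.2]⟩)

end Horizontal

section Distance

theorem ccDist_le_length {γ : ℝ → G} (hγ : G.IsHorizontal γ) :
    G.ccDist (γ 0) (γ 1) ≤ G.length γ :=
  iInf₂_le _ ⟨hγ, rfl, rfl⟩

theorem le_ccDist {x y : G} {C : ℝ≥0∞}
    (h : ∀ γ, G.IsHorizontal γ → γ 0 = x → γ 1 = y → C ≤ G.length γ) : C ≤ G.ccDist x y :=
  le_iInf₂ fun γ hγ => h γ hγ.1 hγ.2.1 hγ.2.2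

theorem exists_length_lt_of_ccDist_lt {x y : G} {r : ℝ≥0∞} (h : G.ccDist x y < r) :
    ∃ γ, G.IsHorizontal γ ∧ γ 0 = x ∧ γ 1 = y ∧ G.length γ < r := by
  simp only [ccDist, iInf_lt_iff] at h
  obtain ⟨γ, ⟨hγ, h0, h1⟩, hlt⟩ := h
  exact ⟨γ, hγ, h0, h1, hlt⟩

theorem ccDist_self (a : G) : G.ccDist a a = 0 :=
  le_antisymm ((ccDist_le_length (isHorizontal_const a)).trans_eq (length_const a)) zero_le

theorem ccDist_le_lengthOn {γ : ℝ → G} (hγ : G.IsHorizontal γ) {a b : ℝ}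
    (ha : a ∈ Icc (0 : ℝ) 1) (hb : b ∈ Icc (0 : ℝ) 1) :
    G.ccDist (γ a) (γ b) ≤ lengthOn γ (uIcc a b) := by
  rcases eq_or_ne a b with rfl | hab
  · rw [ccDist_self]
    exact zero_le
  · have := ccDist_le_length (isHorizontal_affineRestrict hγ hab ha hb)
    rw [length_affineRestrict γ hab] at this
    simpa [affineRestrict] using this

theorem ccDist_mul_left (a x y : G) : G.ccDist (a * x) (a * y) = G.ccDist x y := by
  have hle (a x y : G) : G.ccDist (a * x) (a * y) ≤ G.ccDist x y :=
    le_ccDist fun γ hγ h0 h1 => by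
      have := ccDist_le_length (isHorizontal_const_mul hγ a)
      rwa [h0, h1, length_const_mul] at this
  exact le_antisymm (hle a x y) (by simpa using hle a⁻¹ (a * x) (a * y))

theorem ccDist_comm (x y : G) : G.ccDist x y = G.ccDist y x := by
  have hle (x y : G) : G.ccDist x y ≤ G.ccDist y x :=
    le_ccDist fun γ hγ h0 h1 => by
      have := ccDist_le_lengthOn hγ (a := 1) (b := 0) (by simp) (by simp)
      rw [h0, h1] at this
      simpa [length_eq_lengthOn] using this
  exact le_antisymm (hle _ _) (hle _ _)

theorem ccDist_triangle (x y z : G) : G.ccDist x z ≤ G.ccDist x y + G.ccDist y z := by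
  refine ENNReal.le_of_forall_pos_le_add fun ε hε hfin => ?_
  have hε2 : (0 : ℝ≥0∞) < ε / 2 := ENNReal.half_pos (by exact_mod_cast hε.ne')
  obtain ⟨hxy, hyz⟩ := ENNReal.add_lt_top.1 hfin
  obtain ⟨γ₁, h₁, rfl, rfl, hlen₁⟩ :=
    exists_length_lt_of_ccDist_lt (ENNReal.lt_add_right hxy.ne hε2.ne')
  obtain ⟨γ₂, h₂, h₂0, rfl, hlen₂⟩ :=
    exists_length_lt_of_ccDist_lt (ENNReal.lt_add_right hyz.ne hε2.ne')
  calc G.ccDist (γ₁ 0) (γ₂ 1) ≤ G.length (concat γ₁ γ₂) := by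
        simpa only [concat_zero, concat_one] using
          ccDist_le_length (isHorizontal_concat h₁ h₂ h₂0.symm)
    _ ≤ G.length γ₁ + G.length γ₂ := length_concat_le _ _
    _ ≤ (G.ccDist (γ₁ 0) (γ₁ 1) + ε / 2) + (G.ccDist (γ₁ 1) (γ₂ 1) + ε / 2) := by gcongr
    _ = _ := by rw [add_add_add_comm, ENNReal.add_halves]

end Distance

end CarnotGroup

section Manifold

variable {E M : Type*} [NormedAddCommGroup E] [NormedSpace ℝ E] [FiniteDimensional ℝ E]
  [TopologicalSpace M] [ChartedSpace E M] [IsManifold 𝓘(ℝ, E) ∞ M] [T2Space M]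

theorem exists_contMDiff_eventuallyEq_extChartAt (x₀ : M) :
    ∃ Φ : M → E, ContMDiff 𝓘(ℝ, E) 𝓘(ℝ, E) ∞ Φ ∧ Φ =ᶠ[𝓝 x₀] extChartAt 𝓘(ℝ, E) x₀ := by
  obtain ⟨f, -⟩ := (SmoothBumpFunction.nhds_basis_support (I := 𝓘(ℝ, E)) (c := x₀)
    univ_mem).ex_mem
  refine ⟨fun x => f x • extChartAt 𝓘(ℝ, E) x₀ x, f.contMDiff_smul contMDiffOn_extChartAt, ?_⟩
  filter_upwards [f.eventuallyEq_one] with x hx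
  simp [hx]

theorem exists_contMDiff_hasCompactSupport_of_mem_nhds {x₀ : M} {U : Set M} (hU : U ∈ 𝓝 x₀) :
    ∃ φ : M → ℝ, ContMDiff 𝓘(ℝ, E) 𝓘(ℝ, ℝ) ∞ φ ∧ HasCompactSupport φ ∧ φ x₀ = 1 ∧
      Function.support φ ⊆ U := by
  obtain ⟨f, -, hf⟩ := (SmoothBumpFunction.nhds_basis_support (I := 𝓘(ℝ, E)) hU).mem_iff.1 hU
  exact ⟨f, f.contMDiff, f.hasCompactSupport, f.eq_one, hf⟩

end Manifold

theorem ennreal_le_mul_pow_of_forall_lt {A d : ℝ≥0∞} {C : ℝ≥0} (hC : C ≠ 0) {n : ℕ} (hn : n ≠ 0)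
    (h : ∀ r : ℝ≥0, d < r → A ≤ C * r ^ n) : A ≤ C * d ^ n := by
  rcases eq_or_ne d ⊤ with rfl | hd
  · simp [ENNReal.top_pow hn, ENNReal.mul_top, hC]
  have hcont : Continuous fun r : ℝ≥0∞ => (C : ℝ≥0∞) * r ^ n :=
    (ENNReal.continuous_const_mul ENNReal.coe_ne_top).comp (ENNReal.continuous_pow n)
  have : (𝓝[>] d).NeBot := nhdsGT_neBot_of_exists_gt ⟨⊤, hd.lt_top⟩
  refine ge_of_tendsto (x := 𝓝[>] d) ((hcont.tendsto d).mono_left nhdsWithin_le_nhds) ?_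
  filter_upwards [self_mem_nhdsWithin, nhdsWithin_le_nhds (Iio_mem_nhds hd.lt_top)] with r hr hr'
  lift r to ℝ≥0 using (mem_Iio.1 hr').ne
  exact h r hr

namespace CarnotGroup

variable {G : CarnotGroup.{u}}

section Regularity

theorem IsHorizontal.continuousOn {γ : ℝ → G} (hγ : G.IsHorizontal γ) :
    ContinuousOn γ (Icc 0 1) := by
  intro t ht U hU
  obtain ⟨φ, hφ, -, hone, hsupp⟩ :=
    exists_contMDiff_hasCompactSupport_of_mem_nhds (E := G.Coord) hU
  have hcont := (hγ.absolutelyContinuous φ hφ).continuousOn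
  rw [uIcc_of_le zero_le_one] at hcont
  exact ((hcont t ht).eventually (isOpen_ne.mem_nhds (by simp [hone]))).mono fun s hs => hsupp hs

theorem IsHorizontal.ae_differentiableAt_comp {γ : ℝ → G} (hγ : G.IsHorizontal γ) {Φ : G → G.Coord}
    (hΦ : ContMDiff G.model 𝓘(ℝ, G.Coord) ∞ Φ) :
    ∀ᵐ t : ℝ, t ∈ Ioo (0 : ℝ) 1 → DifferentiableAt ℝ (fun s => Φ (γ s)) t := by
  have hcoord (i : Fin G.dim) : ContMDiff G.model 𝓘(ℝ, ℝ) ∞ fun x => Φ x i :=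
    (EuclideanSpace.proj (𝕜 := ℝ) i).contDiff.contMDiff.comp hΦ
  filter_upwards [ae_all_iff.2 fun i =>
    (hγ.absolutelyContinuous _ (hcoord i)).ae_differentiableAt] with t ht htmem
  refine differentiableAt_euclidean.2 fun i => ht i ?_
  rw [uIcc_of_le zero_le_one]
  exact Ioo_subset_Icc_self htmem

theorem IsHorizontal.ae_mdifferentiableAt {γ : ℝ → G} (hγ : G.IsHorizontal γ) :
    ∀ᵐ t ∂(volume.restrict (Icc (0 : ℝ) 1)), MDifferentiableAt 𝓘(ℝ, ℝ) G.model γ t := by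
  rw [← restrict_Ioo_eq_restrict_Icc, ae_restrict_iff' measurableSet_Ioo, ae_iff]
  push Not
  have hcont : ∀ t ∈ Ioo (0 : ℝ) 1, ContinuousAt γ t := fun t ht =>
    hγ.continuousOn.continuousAt (Icc_mem_nhds ht.1 ht.2)
  refine measure_null_of_locally_null _ fun t₀ ht₀ => ?_
  have : IsManifold 𝓘(ℝ, G.Coord) 1 G := IsManifold.of_le (n := ∞) (by norm_num)
  obtain ⟨Φ, hΦ, hΦeq⟩ := exists_contMDiff_eventuallyEq_extChartAt (E := G.Coord) (γ t₀)
  obtain ⟨O, hO, hOopen, ht₀O⟩ := eventually_nhds_iff.1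
    (hΦeq.and ((chartAt G.Coord (γ t₀)).open_source.mem_nhds (mem_chart_source _ (γ t₀))))
  refine ⟨_, inter_mem_nhdsWithin _
    ((hcont t₀ ht₀.1).preimage_mem_nhds (hOopen.mem_nhds ht₀O)), ?_⟩
  refine measure_mono_null ?_ (ae_iff.1 (hγ.ae_differentiableAt_comp hΦ))
  rintro t ⟨⟨ht, hnot⟩, htO⟩ hdiff
  refine hnot ((mdifferentiableAt_iff_target_of_mem_source (hO _ htO).2).2 ⟨hcont t ht, ?_⟩)
  refine ((hdiff ht).congr_of_eventuallyEq ?_).mdifferentiableAt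
  filter_upwards [(hcont t ht).preimage_mem_nhds (hOopen.mem_nhds htO)] with s hs
  exact (hO _ hs).1.symm

theorem IsHorizontal.ccDist_le_length {γ : ℝ → G} (hγ : G.IsHorizontal γ) {t : ℝ}
    (ht : t ∈ Icc (0 : ℝ) 1) : G.ccDist (γ 0) (γ t) ≤ G.length γ := by
  refine (ccDist_le_lengthOn hγ (left_mem_Icc.2 zero_le_one) ht).trans (lengthOn_mono γ ?_)
  rw [uIcc_of_le ht.1]
  exact Icc_subset_Icc_right ht.2

end Regularity

section InnerProduct

instance : FiniteDimensional ℝ G.LieAlg := inferInstanceAs (FiniteDimensional ℝ G.Coord)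

theorem algNorm_nonneg (X : G.LieAlg) : 0 ≤ G.algNorm X := Real.sqrt_nonneg _

theorem ip_self_nonneg (X : G.LieAlg) : 0 ≤ G.ip X X := by
  rcases eq_or_ne X 0 with rfl | h
  · simp
  · exact (G.ip_pos X h).le

theorem abs_ip_le (X Y : G.LieAlg) : |G.ip X Y| ≤ G.algNorm X * G.algNorm Y := by
  rw [algNorm, algNorm, ← Real.sqrt_mul (ip_self_nonneg X), ← Real.sqrt_sq_eq_abs]
  exact Real.sqrt_le_sqrt
    (LinearMap.BilinForm.apply_sq_le_of_symm G.ip ip_self_nonneg ⟨G.ip_symm⟩ X Y)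

theorem exists_abs_le_algNorm (l : G.LieAlg →ₗ[ℝ] ℝ) :
    ∃ C : ℝ≥0, ∀ X, |l X| ≤ C * G.algNorm X := by
  have hinj : Function.Injective G.ip := by
    rw [injective_iff_map_eq_zero]
    intro X hX
    by_contra h
    exact (G.ip_pos X h).ne' (by rw [hX]; rfl)
  have hsurj : Function.Surjective G.ip :=
    (LinearMap.injective_iff_surjective_of_finrank_eq_finrank
      (Subspace.dual_finrank_eq (K := ℝ) (V := G.LieAlg)).symm).1 hinj
  obtain ⟨W, rfl⟩ := hsurj l
  exact ⟨⟨G.algNorm W, algNorm_nonneg W⟩, fun X => abs_ip_le W X⟩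

theorem exists_frame_abs_le (S : Submodule ℝ G.LieAlg) :
    ∃ (n : ℕ) (b : Fin n → G.LieAlg) (C : Fin n → ℝ≥0), (∀ i, b i ∈ S) ∧
      ∀ (L : G.LieAlg →ₗ[ℝ] ℝ), ∀ X ∈ S, |L X| ≤ (∑ i, C i * |L (b i)|) * G.algNorm X := by
  let B := Module.finBasis ℝ S
  have hcoord (i) : ∃ C : ℝ≥0, ∀ X : S, |B.coord i X| ≤ C * G.algNorm X := by
    obtain ⟨l, hl⟩ := (B.coord i).exists_extend
    obtain ⟨C, hC⟩ := exists_abs_le_algNorm l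
    exact ⟨C, fun X => hl ▸ hC X⟩
  choose C hC using hcoord
  refine ⟨_, fun i => (B i : G.LieAlg), C, fun i => (B i).2, fun L X hX => ?_⟩
  have hexpand : L X = ∑ i, B.coord i ⟨X, hX⟩ * L (B i) := by
    have hL := congrArg (fun Y : S => L Y) (B.sum_repr ⟨X, hX⟩)
    simp only at hL
    rw [← hL, Submodule.coe_sum, map_sum]
    refine Finset.sum_congr rfl fun i _ => ?_
    rw [Submodule.coe_smul, map_smul]
    rfl
  rw [hexpand, Finset.sum_mul]
  refine (Finset.abs_sum_le_sum_abs _ _).trans (Finset.sum_le_sum fun i _ => ?_)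
  rw [abs_mul, mul_right_comm]
  exact mul_le_mul_of_nonneg_right (hC i ⟨X, hX⟩) (abs_nonneg _)

end InnerProduct

section SmoothFunctions

theorem abs_sub_le_of_leftDiff_le {φ : G → ℝ} (hφ : ContMDiff G.model 𝓘(ℝ, ℝ) ∞ φ) {γ : ℝ → G}
    (hγ : G.IsHorizontal γ) {K : ℝ≥0} (hK : ∀ t ∈ Icc (0 : ℝ) 1, ∀ X : G.LieAlg, X ∈ G.layer 1 →
      |leftDiff G.Coord φ (γ t) X| ≤ K * G.algNorm X) :
    ENNReal.ofReal |φ (γ 1) - φ (γ 0)| ≤ K * G.length γ := by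
  rw [← (hγ.absolutelyContinuous φ hφ).integral_deriv_eq_sub,
    intervalIntegral.integral_of_le zero_le_one, ← integral_Icc_eq_integral_Ioc,
    ← Real.norm_eq_abs, ofReal_norm]
  refine (enorm_integral_le_lintegral_enorm _).trans ?_
  rw [length, ← lintegral_const_mul' _ _ ENNReal.coe_ne_top]
  refine lintegral_mono_ae ?_
  filter_upwards [hγ.horizontal, hγ.ae_mdifferentiableAt, ae_restrict_mem measurableSet_Icc]
    with t hhor hdiff ht
  rw [(hasDerivAt_comp_curve hφ hdiff).deriv, ← ofReal_norm, Real.norm_eq_abs,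
    ← ENNReal.ofReal_coe_nnreal]
  exact (ENNReal.ofReal_le_ofReal (hK t ht _ hhor)).trans_eq (ENNReal.ofReal_mul K.2)

theorem exists_lipschitz {φ : G → ℝ} (hφ : ContMDiff G.model 𝓘(ℝ, ℝ) ∞ φ)
    (hsupp : HasCompactSupport φ) :
    ∃ C : ℝ≥0, ∀ x y, ENNReal.ofReal |φ y - φ x| ≤ C * G.ccDist x y := by
  obtain ⟨n, b, C, -, hC⟩ := exists_frame_abs_le (G.layer 1)
  have hbound (i) : ∃ M : ℝ≥0, ∀ g : G, |leftDiff G.Coord φ g (b i)| ≤ M := by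
    obtain ⟨M, hM⟩ := (hasCompactSupport_leftDiff (E := G.Coord) hsupp
      (b i)).exists_bound_of_continuous (contMDiff_leftDiff (E := G.Coord) hφ (b i)).continuous
    exact ⟨M.toNNReal, fun g => (hM g).trans (Real.le_coe_toNNReal M)⟩
  choose M hM using hbound
  refine ⟨∑ i, C i * M i + 1, fun x y => ?_⟩
  rw [← pow_one (G.ccDist x y)]
  refine ennreal_le_mul_pow_of_forall_lt (by positivity) one_ne_zero fun r hr => ?_
  obtain ⟨γ, hγ, rfl, rfl, hlen⟩ := exists_length_lt_of_ccDist_lt hr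
  refine (abs_sub_le_of_leftDiff_le hφ hγ (K := ∑ i, C i * M i + 1) fun t _ X hX => ?_).trans
    (by rw [pow_one]; gcongr)
  refine (hC (leftDiff G.Coord φ (γ t)).toLinearMap X hX).trans
    (mul_le_mul_of_nonneg_right ?_ (algNorm_nonneg X))
  push_cast
  refine le_add_of_le_of_nonneg (Finset.sum_le_sum fun i _ => ?_) zero_le_one
  exact mul_le_mul_of_nonneg_left (hM i _) (C i).2

theorem exists_abs_sub_le_ccDist_sq {φ : G → ℝ} (hφ : ContMDiff G.model 𝓘(ℝ, ℝ) ∞ φ)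
    (hsupp : HasCompactSupport φ)
    (hcrit : ∀ X : G.LieAlg, X ∈ G.layer 1 → leftDiff G.Coord φ 1 X = 0) :
    ∃ C : ℝ≥0, ∀ g, ENNReal.ofReal |φ g - φ 1| ≤ C * G.ccDist 1 g ^ 2 := by
  obtain ⟨n, b, C, hb, hC⟩ := exists_frame_abs_le (G.layer 1)
  have hlip (i) : ∃ M : ℝ≥0, ∀ x y : G, ENNReal.ofReal |leftDiff G.Coord φ y (b i) -
      leftDiff G.Coord φ x (b i)| ≤ M * G.ccDist x y :=
    exists_lipschitz (contMDiff_leftDiff (E := G.Coord) hφ (b i))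
      (hasCompactSupport_leftDiff (E := G.Coord) hsupp (b i))
  choose M hM using hlip
  have hleft (i) {g : G} {r : ℝ≥0} (hg : G.ccDist 1 g ≤ r) :
      |leftDiff G.Coord φ g (b i)| ≤ M i * r := by
    have h := (hM i 1 g).trans (mul_le_mul_right hg (M i : ℝ≥0∞))
    rw [hcrit _ (hb i), sub_zero, ← ENNReal.coe_mul] at h
    simpa using (ENNReal.ofReal_le_iff_le_toReal ENNReal.coe_ne_top).1 h
  refine ⟨∑ i, C i * M i + 1, fun g =>
    ennreal_le_mul_pow_of_forall_lt (by positivity) two_ne_zero fun r hr => ?_⟩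
  obtain ⟨γ, hγ, h0, rfl, hlen⟩ := exists_length_lt_of_ccDist_lt hr
  have hsub := abs_sub_le_of_leftDiff_le hφ hγ (K := (∑ i, C i * M i + 1) * r) fun t ht X hX => ?_
  · rw [h0] at hsub
    refine hsub.trans ?_
    rw [pow_two, ENNReal.coe_mul, mul_assoc]
    gcongr
  · have hdist : G.ccDist 1 (γ t) ≤ r := h0 ▸ (hγ.ccDist_le_length ht).trans hlen.le
    refine (hC (leftDiff G.Coord φ (γ t)).toLinearMap X hX).trans
      (mul_le_mul_of_nonneg_right ?_ (algNorm_nonneg X))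
    push_cast
    rw [add_mul, Finset.sum_mul, one_mul]
    refine le_add_of_le_of_nonneg (Finset.sum_le_sum fun i _ => ?_) r.2
    rw [mul_assoc]
    exact mul_le_mul_of_nonneg_left (hleft i hdist) (C i).2

theorem exists_ccDist_lt_subset {U : Set G} (hU : U ∈ 𝓝 (1 : G)) :
    ∃ ε : ℝ≥0, 0 < ε ∧ ∀ g, G.ccDist 1 g < ε → g ∈ U := by
  obtain ⟨φ, hφ, hsupp, hone, hφU⟩ :=
    exists_contMDiff_hasCompactSupport_of_mem_nhds (E := G.Coord) hU
  obtain ⟨C, hC⟩ := exists_lipschitz hφ hsupp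
  refine ⟨(C + 1)⁻¹, by positivity, fun g hg => hφU fun hzero => ?_⟩
  have hle : (1 : ℝ≥0∞) ≤ ((C * (C + 1)⁻¹ : ℝ≥0) : ℝ≥0∞) := by
    calc (1 : ℝ≥0∞) = ENNReal.ofReal |φ g - φ 1| := by simp [hzero, hone]
      _ ≤ C * G.ccDist 1 g := hC 1 g
      _ ≤ C * ((C + 1)⁻¹ : ℝ≥0) := by gcongr
      _ = _ := (ENNReal.coe_mul _ _).symm
  have hlt : C * (C + 1)⁻¹ < 1 := by
    rw [← div_eq_mul_inv, div_lt_one (by positivity)]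
    exact lt_add_one C
  exact hlt.not_ge (by exact_mod_cast hle)

end SmoothFunctions

end CarnotGroup

section SuperlinearIncrements

theorem sum_range_setLIntegral_Icc (w : ℝ → ℝ≥0∞) {p : ℕ → ℝ} (hp : Monotone p) (n : ℕ) :
    ∑ i ∈ Finset.range n, ∫⁻ t in Icc (p i) (p (i + 1)), w t = ∫⁻ t in Icc (p 0) (p n), w t := by
  simp only [setLIntegral_congr Ioc_ae_eq_Icc.symm]
  induction n with
  | zero => simp
  | succ n ih =>
    rw [Finset.sum_range_succ, ih, ← lintegral_union measurableSet_Ioc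
      (Ioc_disjoint_Ioc_of_le le_rfl), Ioc_union_Ioc_eq_Ioc (hp n.zero_le) (hp n.le_succ)]

theorem exists_forall_setLIntegral_Icc_div_lt {w : ℝ → ℝ≥0∞}
    (hw : ∫⁻ t in Icc (0 : ℝ) 1, w t ≠ ⊤) {δ : ℝ≥0∞} (hδ : δ ≠ 0) :
    ∃ n : ℕ, n ≠ 0 ∧ ∀ i < n, ∫⁻ t in Icc (i / n : ℝ) ((i + 1 : ℕ) / n), w t < δ := by
  obtain ⟨η, hη, hsmall⟩ := exists_pos_setLIntegral_lt_of_measure_lt hw hδ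
  obtain ⟨n, hn⟩ := ENNReal.exists_inv_nat_lt hη.ne'
  have hn0 : n ≠ 0 := by rintro rfl; simp at hn
  have hnpos : (0 : ℝ) < n := by positivity
  refine ⟨n, hn0, fun i hi => ?_⟩
  have hsub : Icc (i / n : ℝ) ((i + 1 : ℕ) / n) ⊆ Icc 0 1 :=
    Icc_subset_Icc (by positivity) ((div_le_one hnpos).2 (by exact_mod_cast hi))
  have hvol : volume.restrict (Icc (0 : ℝ) 1) (Icc (i / n : ℝ) ((i + 1 : ℕ) / n)) < η := by
    refine (Measure.restrict_apply_le _ _).trans_lt ?_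
    rwa [Real.volume_Icc, ← sub_div, Nat.cast_succ, add_sub_cancel_left, one_div,
      ENNReal.ofReal_inv_of_pos hnpos, ENNReal.ofReal_natCast]
  have hlt := hsmall _ hvol
  rwa [Measure.restrict_restrict measurableSet_Icc, inter_eq_left.2 hsub] at hlt

theorem rpow_le_mul_rpow_sub_one {a δ : ℝ≥0∞} (h : a ≤ δ) {α : ℝ} (hα : 1 ≤ α) :
    a ^ α ≤ a * δ ^ (α - 1) := by
  calc a ^ α = a ^ (1 + (α - 1)) := by rw [add_sub_cancel]
    _ = a * a ^ (α - 1) := by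
      rw [ENNReal.rpow_add_of_nonneg _ _ zero_le_one (sub_nonneg.2 hα), ENNReal.rpow_one]
    _ ≤ a * δ ^ (α - 1) := by gcongr

variable {X : Type*} {w : ℝ → ℝ≥0∞} {f : ℝ → X} {α : ℝ} {K : ℝ≥0} {ε : ℝ≥0∞}

theorem edist_le_mul_setLIntegral_mul_rpow [PseudoEMetricSpace X]
    (hw : ∫⁻ t in Icc (0 : ℝ) 1, w t ≠ ⊤) (hα : 1 ≤ α)
    (hf : ∀ s ∈ Icc (0 : ℝ) 1, ∀ t ∈ Icc (0 : ℝ) 1, s ≤ t → ∫⁻ τ in Icc s t, w τ < ε →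
      edist (f s) (f t) ≤ K * (∫⁻ τ in Icc s t, w τ) ^ α) {δ : ℝ≥0∞} (hδ : δ ≠ 0) (hδε : δ < ε) :
    edist (f 0) (f 1) ≤ K * ((∫⁻ t in Icc (0 : ℝ) 1, w t) * δ ^ (α - 1)) := by
  obtain ⟨n, hn, hsmall⟩ := exists_forall_setLIntegral_Icc_div_lt hw hδ
  let p : ℕ → ℝ := fun i => i / n
  have hmono : Monotone p := fun i j hij => by simp only [p]; gcongr
  have hp0 : p 0 = 0 := by simp [p]
  have hpn : p n = 1 := by simp [p, hn]
  have hmem (i) (hi : i ≤ n) : p i ∈ Icc (0 : ℝ) 1 :=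
    ⟨hp0 ▸ hmono i.zero_le, hpn ▸ hmono hi⟩
  calc edist (f 0) (f 1) = edist (f (p 0)) (f (p n)) := by rw [hp0, hpn]
    _ ≤ ∑ i ∈ Finset.range n, edist (f (p i)) (f (p (i + 1))) :=
      edist_le_range_sum_edist (fun i => f (p i)) n
    _ ≤ ∑ i ∈ Finset.range n, K * ((∫⁻ t in Icc (p i) (p (i + 1)), w t) * δ ^ (α - 1)) := by
      refine Finset.sum_le_sum fun i hi => ?_
      have hi := Finset.mem_range.1 hi
      refine (hf _ (hmem i hi.le) _ (hmem (i + 1) hi) (hmono i.le_succ)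
        ((hsmall i hi).trans hδε)).trans ?_
      gcongr
      exact rpow_le_mul_rpow_sub_one (hsmall i hi).le hα
    _ = K * ((∫⁻ t in Icc (0 : ℝ) 1, w t) * δ ^ (α - 1)) := by
      rw [← Finset.mul_sum, ← Finset.sum_mul, sum_range_setLIntegral_Icc w hmono, hp0, hpn]

theorem eq_of_edist_le_setLIntegral_rpow [EMetricSpace X]
    (hw : ∫⁻ t in Icc (0 : ℝ) 1, w t ≠ ⊤) (hα : 1 < α) (hε : 0 < ε)
    (hf : ∀ s ∈ Icc (0 : ℝ) 1, ∀ t ∈ Icc (0 : ℝ) 1, s ≤ t → ∫⁻ τ in Icc s t, w τ < ε →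
      edist (f s) (f t) ≤ K * (∫⁻ τ in Icc s t, w τ) ^ α) : f 0 = f 1 := by
  let B : ℝ≥0∞ → ℝ≥0∞ := fun δ => K * ((∫⁻ t in Icc (0 : ℝ) 1, w t) * δ ^ (α - 1))
  have hcont : Continuous B := (ENNReal.continuous_const_mul ENNReal.coe_ne_top).comp
    ((ENNReal.continuous_const_mul hw).comp ENNReal.continuous_rpow_const)
  have hB0 : B 0 = 0 := by simp [B, ENNReal.zero_rpow_of_pos (sub_pos.2 hα)]
  have : (𝓝[>] (0 : ℝ≥0∞)).NeBot := nhdsGT_neBot_of_exists_gt ⟨⊤, ENNReal.zero_lt_top⟩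
  refine edist_le_zero.1 (ge_of_tendsto (x := 𝓝[>] 0)
    ((hcont.tendsto' 0 0 hB0).mono_left nhdsWithin_le_nhds) ?_)
  filter_upwards [self_mem_nhdsWithin, nhdsWithin_le_nhds (Iio_mem_nhds hε)] with δ hδ hδε
  exact edist_le_mul_setLIntegral_mul_rpow hw hα.le hf (ne_of_gt hδ) hδε

end SuperlinearIncrements

/-! ### Chow's theorem -/

theorem hasStrictDerivAt_euclidean {n : ℕ} {f : ℝ → EuclideanSpace ℝ (Fin n)}
    {x : EuclideanSpace ℝ (Fin n)} {t : ℝ} :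
    HasStrictDerivAt f x t ↔ ∀ i, HasStrictDerivAt (fun s => f s i) (x i) t := by
  simp only [hasStrictDerivAt_iff_hasStrictFDerivAt, hasStrictFDerivAt_euclidean]
  refine forall_congr' fun i => ?_
  have hproj : EuclideanSpace.proj i ∘L ContinuousLinearMap.toSpanSingleton ℝ x =
      ContinuousLinearMap.toSpanSingleton ℝ (x i) := by ext; simp
  rw [hproj]

namespace CarnotGroup

variable {G : CarnotGroup.{u}}

section ConstantVelocity

variable {γ : ℝ → G} {X : G.LieAlg}

theorem length_of_leftDeriv_eq (hγ : ∀ t ∈ Icc (0 : ℝ) 1, G.leftDeriv γ t = X) :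
    G.length γ = ENNReal.ofReal (G.algNorm X) := by
  rw [length, setLIntegral_congr_fun (g := fun _ => ENNReal.ofReal (G.algNorm X))
    measurableSet_Icc fun t ht => by simp only [hγ t ht]]
  simp

theorem isHorizontal_of_leftDeriv_eq
    (hdiff : ∀ t ∈ Icc (0 : ℝ) 1, MDifferentiableAt 𝓘(ℝ, ℝ) G.model γ t)
    (hγ : ∀ t ∈ Icc (0 : ℝ) 1, G.leftDeriv γ t = X) (hX : X ∈ G.layer 1) : G.IsHorizontal γ := by
  rw [← uIcc_of_le zero_le_one] at hdiff hγ
  refine ⟨fun φ hφ => ?_, ?_⟩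
  · have hcont : ContinuousOn (fun t => leftDiff G.Coord φ (γ t) X) (uIcc 0 1) := fun t ht =>
      (ContinuousAt.comp (contMDiff_leftDiff (E := G.Coord) hφ X).continuous.continuousAt
        (hdiff t ht).continuousAt).continuousWithinAt
    refine absolutelyContinuousOnInterval_of_eq_integral hcont.intervalIntegrable fun t ht => ?_
    rw [intervalIntegral.integral_eq_sub_of_hasDerivAt (f := fun t => φ (γ t)) (fun s hs => ?_)
      (hcont.mono (uIcc_subset_uIcc_left ht)).intervalIntegrable, add_sub_cancel]
    have hs' := uIcc_subset_uIcc_left ht hs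
    exact hγ s hs' ▸ hasDerivAt_comp_curve hφ (hdiff s hs')
  · rw [← uIcc_of_le zero_le_one, ae_restrict_iff' measurableSet_uIcc]
    exact ae_of_all _ fun t ht => hγ t ht ▸ hX

end ConstantVelocity

/-- A local one-parameter subgroup `t ↦ exp (t X)`, encoded as a curve starting at the identity
whose left-trivialized velocity is `X` near `0`. -/
structure IsLocalExp (e : ℝ → G) (X : G.LieAlg) : Prop where
  map_zero : e 0 = 1
  eventually : ∀ᶠ t in 𝓝 (0 : ℝ), MDifferentiableAt 𝓘(ℝ, ℝ) G.model e t ∧ G.leftDeriv e t = X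

theorem mfderiv_inv_mul_mulInvariantVectorField (X : G.LieAlg) (g : G) :
    (mfderiv G.model G.model (fun x : G => g⁻¹ * x) g : G.Coord →L[ℝ] G.Coord)
      (mulInvariantVectorField X g) = X := by
  have hcomp := hasMFDerivAt_comp_of_eq (mdifferentiable_const_mul g⁻¹ g).hasMFDerivAt
    (mdifferentiable_const_mul g 1).hasMFDerivAt (mul_one g)
  have hid : (fun x : G => g⁻¹ * (g * x)) = id := by ext; simp
  rw [hid] at hcomp
  exact congrArg (fun L : G.Coord →L[ℝ] G.Coord => L X)
    (hasMFDerivAt_unique hcomp (hasMFDerivAt_id 1))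

theorem exists_isLocalExp (X : G.LieAlg) : ∃ e : ℝ → G, IsLocalExp e X := by
  have : LieGroup G.model (minSmoothness ℝ 3) G := by
    rw [minSmoothness_of_isRCLikeNormedField]; infer_instance
  have : IsManifold G.model 1 G := IsManifold.of_le (n := ∞) (by norm_num)
  have hsmooth := (contMDiffAt_mulInvariantVectorField (I := G.model) (G := G) X (g := 1)).of_le
    (m := 1) (by rw [minSmoothness_of_isRCLikeNormedField]; norm_num)
  obtain ⟨e, hzero, he⟩ := exists_isMIntegralCurveAt_of_contMDiffAt_boundaryless (t₀ := 0) hsmooth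
  refine ⟨e, hzero, he.mono fun t ht => ⟨ht.mdifferentiableAt, ?_⟩⟩
  have hvelocity : (mfderiv 𝓘(ℝ, ℝ) G.model e t : ℝ →L[ℝ] G.Coord) 1 =
      mulInvariantVectorField X (e t) :=
    (congrArg (fun L : ℝ →L[ℝ] G.Coord => L 1) ht.mfderiv).trans
      (one_smul ℝ (mulInvariantVectorField X (e t) : G.Coord))
  exact (congrArg (mfderiv G.model G.model (fun x : G => (e t)⁻¹ * x) (e t) :
    G.Coord →L[ℝ] G.Coord) hvelocity).trans (mfderiv_inv_mul_mulInvariantVectorField X (e t))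

namespace IsLocalExp

variable {e : ℝ → G} {X : G.LieAlg}

theorem hasMFDerivAt (h : IsLocalExp e X) : HasMFDerivAt 𝓘(ℝ, ℝ) G.model e 0
    (ContinuousLinearMap.toSpanSingleton ℝ (X : G.Coord)) := by
  obtain ⟨hdiff, hX⟩ := h.eventually.self_of_nhds
  rw [leftDeriv_eq_mfderiv] at hX
  have hderiv := ((mdifferentiableAt_const_mul_iff (e 0)⁻¹).2 hdiff).hasMFDerivAt
  have hspan : (mfderiv 𝓘(ℝ, ℝ) G.model (fun s => (e 0)⁻¹ * e s) 0 : ℝ →L[ℝ] G.Coord) =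
      ContinuousLinearMap.toSpanSingleton ℝ (X : G.Coord) :=
    ContinuousLinearMap.ext_ring (hX.trans (one_smul ℝ (X : G.Coord)).symm)
  have hcurve : (fun s => (e 0)⁻¹ * e s) = e := by ext s; simp [h.map_zero]
  rw [hspan, hcurve] at hderiv
  exact hderiv

theorem continuousAt (h : IsLocalExp e X) : ContinuousAt e 0 :=
  h.hasMFDerivAt.continuousAt

theorem hasDerivAt_comp (h : IsLocalExp e X) {F : Type*} [NormedAddCommGroup F] [NormedSpace ℝ F]
    {f : G → F} {L : G.Coord →L[ℝ] F} (hf : HasMFDerivAt G.model 𝓘(ℝ, F) f 1 L) :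
    HasDerivAt (fun t => f (e t)) (L X) 0 := by
  have hderiv := HasFDerivAt.hasDerivAt (𝕜 := ℝ) (F := F)
    (f' := L ∘L ContinuousLinearMap.toSpanSingleton ℝ (X : G.Coord))
    (hasMFDerivAt_iff_hasFDerivAt.1 (hasMFDerivAt_comp_of_eq hf h.hasMFDerivAt h.map_zero))
  exact hderiv.congr_deriv (congrArg L (one_smul ℝ (X : G.Coord)))

theorem hasStrictDerivAt_comp (h : IsLocalExp e X) {φ : G → ℝ}
    (hφ : ContMDiff G.model 𝓘(ℝ, ℝ) ∞ φ) :
    HasStrictDerivAt (fun t => φ (e t)) (leftDiff G.Coord φ (e 0) X) 0 := by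
  refine hasStrictDerivAt_of_hasDerivAt_of_continuousAt
    (f' := fun t => leftDiff G.Coord φ (e t) X) ?_
    (ContinuousAt.comp (contMDiff_leftDiff (E := G.Coord) hφ X).continuous.continuousAt
      h.continuousAt)
  filter_upwards [h.eventually] with t ht
  exact ht.2 ▸ hasDerivAt_comp_curve hφ ht.1

theorem hasStrictDerivAt_chart (h : IsLocalExp e X) :
    HasStrictDerivAt (fun t => chartOne G.Coord G (e t)) (X : G.Coord) 0 := by
  obtain ⟨Φ, hΦ, hΦeq⟩ := exists_contMDiff_eventuallyEq_extChartAt (E := G.Coord) (1 : G)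
  rw [← h.map_zero] at hΦeq
  have hcoord (i : Fin G.dim) : ContMDiff G.model 𝓘(ℝ, ℝ) ∞ fun x => Φ x i :=
    (EuclideanSpace.proj (𝕜 := ℝ) i).contDiff.contMDiff.comp hΦ
  have hderiv := h.hasDerivAt_comp (hasMFDerivAt_chartOne (E := G.Coord) (G := G))
  refine (hasStrictDerivAt_euclidean (x := X)).2 fun i => ?_
  have hstrict : HasStrictDerivAt (fun t => chartOne G.Coord G (e t) i)
      (leftDiff G.Coord (fun x => Φ x i) (e 0) X) 0 := by
    refine (h.hasStrictDerivAt_comp (hcoord i)).congr_of_eventuallyEq ?_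
    filter_upwards [h.continuousAt.eventually hΦeq] with t ht
    rw [ht, h.map_zero]
    rfl
  have hderiv_i := (EuclideanSpace.proj (𝕜 := ℝ) i).hasFDerivAt.comp_hasDerivAt 0 hderiv
  exact hstrict.congr_deriv (hstrict.hasDerivAt.unique hderiv_i)

theorem eventually_ccDist_le (h : IsLocalExp e X) (hX : X ∈ G.layer 1) :
    ∀ᶠ t in 𝓝 (0 : ℝ), G.ccDist 1 (e t) ≤ ENNReal.ofReal (|t| * G.algNorm X) := by
  obtain ⟨δ, hδ, hball⟩ := Metric.eventually_nhds_iff_ball.1 h.eventually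
  filter_upwards [Metric.ball_mem_nhds (0 : ℝ) hδ] with t ht
  rcases eq_or_ne t 0 with rfl | ht0
  · rw [h.map_zero, ccDist_self]; exact zero_le
  have hmem : ∀ τ ∈ Icc (0 : ℝ) 1, 0 + t * τ ∈ Metric.ball (0 : ℝ) δ := fun τ hτ => by
    rw [zero_add, ← smul_eq_mul, smul_eq_mul, mul_comm, ← smul_eq_mul]
    exact (convex_ball (0 : ℝ) δ).smul_mem_of_zero_mem (Metric.mem_ball_self hδ) ht hτ
  have hderiv : ∀ τ ∈ Icc (0 : ℝ) 1, G.leftDeriv (fun τ => e (0 + t * τ)) τ = t • X :=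
    fun τ hτ => by rw [leftDeriv_comp_affine e 0 ht0, (hball _ (hmem τ hτ)).2]
  have hle := ccDist_le_length (isHorizontal_of_leftDeriv_eq
    (fun τ hτ => (mdifferentiableAt_comp_affine_iff e 0 ht0).2 (hball _ (hmem τ hτ)).1)
    hderiv (Submodule.smul_mem _ t hX))
  rwa [length_of_leftDeriv_eq hderiv, algNorm_smul, mul_zero, mul_one, zero_add, zero_add,
    h.map_zero] at hle

theorem tendsto_ccDist (h : IsLocalExp e X) (hX : X ∈ G.layer 1) :
    Tendsto (fun t => G.ccDist 1 (e t)) (𝓝 0) (𝓝 0) := by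
  have hcont : Continuous fun t : ℝ => ENNReal.ofReal (|t| * G.algNorm X) :=
    ENNReal.continuous_ofReal.comp (by fun_prop)
  exact tendsto_of_tendsto_of_tendsto_of_le_of_le' tendsto_const_nhds
    (hcont.tendsto' 0 0 (by simp)) (Eventually.of_forall fun _ => zero_le)
    (h.eventually_ccDist_le hX)

theorem hasDerivAt_adj (h : IsLocalExp e X) (Z : G.LieAlg) :
    HasDerivAt (fun t => adj G.Coord (e t) Z) ((⁅X, Z⁆ : G.LieAlg) : G.Coord) 0 := by
  have hderiv := h.hasDerivAt_comp (hasMFDerivAt_adj_one (E := G.Coord) (G := G))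
  refine HasDerivAt.congr_deriv (F := G.Coord)
    (hderiv.clm_apply (hasDerivAt_const (F := G.Coord) 0 Z)) ?_
  rw [_root_.map_zero, add_zero]
  exact lieBracketL_apply X Z

theorem hasStrictDerivAt_chart_conj (h : IsLocalExp e X) (a : G) :
    HasStrictDerivAt (fun t => chartOne G.Coord G (a * e t * a⁻¹)) (adj G.Coord a X) 0 := by
  have hsmooth : ContDiffAt ℝ ∞
      (fun y => chartOne G.Coord G (a * (chartOne G.Coord G).symm y * a⁻¹)) (coordOne G.Coord G) :=
    (contDiffAt_chartOne_comp (E := G.Coord) (Φ := fun p : G × G => a * p.2 * a⁻¹)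
      ((contMDiff_conj a).comp contMDiff_snd) (by simp)).comp (coordOne G.Coord G)
      (contDiffAt_const.prodMk contDiffAt_id)
  have hstrict := hsmooth.hasStrictFDerivAt (by simp)
  rw [← adj_eq_fderiv, ← chartOne_one, ← h.map_zero] at hstrict
  refine (HasStrictFDerivAt.comp_hasStrictDerivAt (0 : ℝ) (f := fun t => chartOne G.Coord G (e t))
    hstrict h.hasStrictDerivAt_chart).congr_of_eventuallyEq ?_
  have hsource : ∀ᶠ t in 𝓝 (0 : ℝ), e t ∈ (chartOne G.Coord G).source :=
    h.continuousAt (by rw [h.map_zero]; exact chartOne_source_mem_nhds)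
  filter_upwards [hsource] with t ht
  simp [(chartOne G.Coord G).left_inv ht]

end IsLocalExp

end CarnotGroup

section LieGroup

variable {E : Type*} [NormedAddCommGroup E] [NormedSpace ℝ E]
  {G : Type*} [TopologicalSpace G] [ChartedSpace E G] [Group G]
  {T : Type*} [NormedAddCommGroup T] [NormedSpace ℝ T] {t : T}

theorem map_nhds_eq_of_hasStrictFDerivAt_chartOne [CompleteSpace E] [CompleteSpace T] {f : T → G}
    {A : T →L[ℝ] E} (hft : f t = 1) (hfc : ContinuousAt f t)
    (hf : HasStrictFDerivAt (fun s => chartOne E G (f s)) A t) (hA : A.range = ⊤) :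
    map f (𝓝 t) = 𝓝 1 := by
  refine le_antisymm (hft ▸ hfc) ?_
  have hleft : ∀ᶠ g in 𝓝 (1 : G), (chartOne E G).symm (chartOne E G g) = g := by
    filter_upwards [chartOne_source_mem_nhds (E := E)] with g hg using (chartOne E G).left_inv hg
  calc 𝓝 (1 : G) = map (chartOne E G).symm (map (chartOne E G) (𝓝 1)) := by
        rw [map_map]; exact (map_id.symm.trans (map_congr (hleft.mono fun g hg => hg.symm)))
    _ ≤ map (chartOne E G).symm (𝓝 (coordOne E G)) := map_mono tendsto_chartOne
    _ = map (chartOne E G).symm (map (fun s => chartOne E G (f s)) (𝓝 t)) := by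
        rw [hf.map_nhds_eq_of_surj hA, hft, chartOne_one]
    _ = map f (𝓝 t) := by
        rw [map_map]; exact map_congr ((hft ▸ hfc : Tendsto f (𝓝 t) (𝓝 1)).eventually hleft)

variable [LieGroup 𝓘(ℝ, E) ∞ G]

theorem hasStrictFDerivAt_chartMul : HasStrictFDerivAt (chartMul E G)
    (ContinuousLinearMap.fst ℝ E E + ContinuousLinearMap.snd ℝ E E)
    (coordOne E G, coordOne E G) := by
  have hmul := (contDiffAt_chartMul (E := E) (G := G)).hasStrictFDerivAt (by simp)
  refine hmul.congr_fderiv (ContinuousLinearMap.prod_ext ?_ ?_)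
  · rw [← fderiv_comp_prodMk_left hmul.differentiableAt,
      (isLocalGroup_chart E G).fderiv_mul_left]
    ext; simp
  · rw [← fderiv_comp_prodMk_right hmul.differentiableAt,
      (isLocalGroup_chart E G).fderiv_mul_right]
    ext; simp

theorem hasStrictFDerivAt_chartOne_mul {f g : T → G} {A B : T →L[ℝ] E} (hft : f t = 1)
    (hgt : g t = 1) (hfc : ContinuousAt f t) (hgc : ContinuousAt g t)
    (hf : HasStrictFDerivAt (fun s => chartOne E G (f s)) A t)
    (hg : HasStrictFDerivAt (fun s => chartOne E G (g s)) B t) :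
    HasStrictFDerivAt (fun s => chartOne E G (f s * g s)) (A + B) t := by
  have hmul : HasStrictFDerivAt (chartMul E G)
      (ContinuousLinearMap.fst ℝ E E + ContinuousLinearMap.snd ℝ E E)
      (chartOne E G (f t), chartOne E G (g t)) := by
    rw [hft, hgt]; exact hasStrictFDerivAt_chartMul
  refine ((HasStrictFDerivAt.comp t hmul (hf.prodMk hg)).congr_of_eventuallyEq ?_).congr_fderiv
    (by ext; simp)
  have hfs : ∀ᶠ s in 𝓝 t, f s ∈ (chartOne E G).source :=
    hfc (by rw [hft]; exact chartOne_source_mem_nhds)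
  have hgs : ∀ᶠ s in 𝓝 t, g s ∈ (chartOne E G).source :=
    hgc (by rw [hgt]; exact chartOne_source_mem_nhds)
  filter_upwards [hfs, hgs] with s hs hs'
  simp [chartMul, (chartOne E G).left_inv hs, (chartOne E G).left_inv hs']

theorem hasStrictFDerivAt_chartOne_list_prod {ι : Type*} {f : ι → T → G} {A : ι → T →L[ℝ] E}
    (hft : ∀ i, f i t = 1) (hfc : ∀ i, ContinuousAt (f i) t)
    (hf : ∀ i, HasStrictFDerivAt (fun s => chartOne E G (f i s)) (A i) t) (l : List ι) :
    HasStrictFDerivAt (fun s => chartOne E G (l.map fun i => f i s).prod) (l.map A).sum t := by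
  have : IsTopologicalGroup G := topologicalGroup_of_lieGroup 𝓘(ℝ, E) ∞
  induction l with
  | nil => exact hasStrictFDerivAt_const (𝕜 := ℝ) (coordOne E G) t
  | cons i l ih =>
    have hlc : ContinuousAt (fun s => (l.map fun i => f i s).prod) t :=
      tendsto_list_prod l fun i _ => hfc i
    simp only [List.map_cons, List.prod_cons, List.sum_cons]
    exact hasStrictFDerivAt_chartOne_mul (hft i) (List.prod_eq_one (by simp [hft])) (hfc i) hlc
      (hf i) ih

end LieGroup

namespace CarnotGroup

variable {G : CarnotGroup.{u}}

theorem ccDist_one_mul_le (x y : G) : G.ccDist 1 (x * y) ≤ G.ccDist 1 x + G.ccDist 1 y := by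
  refine (ccDist_triangle 1 x (x * y)).trans_eq ?_
  rw [← ccDist_mul_left x 1 y, mul_one]

theorem ccDist_one_inv (x : G) : G.ccDist 1 x⁻¹ = G.ccDist 1 x := by
  rw [← ccDist_mul_left x 1 x⁻¹, mul_one, mul_inv_cancel, ccDist_comm]

theorem ccDist_one_conj_le (a x : G) :
    G.ccDist 1 (a * x * a⁻¹) ≤ 2 * G.ccDist 1 a + G.ccDist 1 x :=
  calc G.ccDist 1 (a * x * a⁻¹) ≤ G.ccDist 1 a + G.ccDist 1 x + G.ccDist 1 a⁻¹ :=
        (ccDist_one_mul_le _ _).trans (by gcongr; exact ccDist_one_mul_le _ _)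
    _ = 2 * G.ccDist 1 a + G.ccDist 1 x := by rw [ccDist_one_inv]; ring

theorem ccDist_one_list_prod_le {ι : Type*} (l : List ι) (c : ι → G) {δ : ℝ≥0∞}
    (h : ∀ i, G.ccDist 1 (c i) ≤ δ) : G.ccDist 1 (l.map c).prod ≤ l.length * δ := by
  induction l with
  | nil => simp [ccDist_self]
  | cons i l ih =>
    calc G.ccDist 1 ((i :: l).map c).prod ≤ G.ccDist 1 (c i) + G.ccDist 1 (l.map c).prod := by
          rw [List.map_cons, List.prod_cons]; exact ccDist_one_mul_le _ _
      _ ≤ δ + l.length * δ := add_le_add (h i) ih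
      _ = (i :: l).length * δ := by rw [List.length_cons]; push_cast; ring

section Chow

variable (G) in
/-- The span of the images of the first layer under the adjoint action of the elements at distance
less than `ε` from the identity. -/
def adjSpan (ε : ℝ≥0∞) : Submodule ℝ G.Coord :=
  Submodule.span ℝ {Z | ∃ a : G, ∃ X ∈ G.layer 1, G.ccDist 1 a < ε ∧ adj G.Coord a X = Z}

theorem adj_mem_adjSpan {g : G} {ε ε' : ℝ≥0∞} (hg : G.ccDist 1 g < ε) {Z : G.Coord}
    (hZ : Z ∈ adjSpan G ε') : adj G.Coord g Z ∈ adjSpan G (ε + ε') := by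
  suffices adjSpan G ε' ≤ (adjSpan G (ε + ε')).comap (adj G.Coord g).toLinearMap from this hZ
  refine Submodule.span_le.2 ?_
  rintro _ ⟨a, X, hX, ha, rfl⟩
  refine Submodule.subset_span ⟨g * a, X, hX, ?_, by rw [adj_mul]; rfl⟩
  exact (ccDist_one_mul_le g a).trans_lt (ENNReal.add_lt_add hg ha)

/-- `⁅X, Y⁆` is the derivative at `0` of `t ↦ Ad (exp (t X)) Y`, a curve in a closed subspace. -/
theorem lie_mem_adjSpan {ε : ℝ≥0∞} (hε : 0 < ε) {X Y : G.LieAlg} (hX : X ∈ G.layer 1)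
    (hY : (Y : G.Coord) ∈ adjSpan G (ε / 2)) :
    ((⁅X, Y⁆ : G.LieAlg) : G.Coord) ∈ adjSpan G ε := by
  obtain ⟨e, he⟩ := exists_isLocalExp X
  have hmem : ∀ᶠ t in 𝓝 (0 : ℝ), adj G.Coord (e t) Y ∈ adjSpan G ε := by
    filter_upwards [(he.tendsto_ccDist hX).eventually_lt_const (ENNReal.half_pos hε.ne')] with t ht
    exact ENNReal.add_halves ε ▸ adj_mem_adjSpan ht hY
  refine (Submodule.closed_of_finiteDimensional (adjSpan G ε)).mem_of_tendsto
    (hasDerivAt_iff_tendsto_slope.1 (he.hasDerivAt_adj Y)) ?_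
  filter_upwards [nhdsWithin_le_nhds hmem] with t ht
  exact (adjSpan G ε).smul_mem _ ((adjSpan G ε).sub_mem ht hmem.self_of_nhds)

theorem mem_adjSpan_of_mem_layer {k : ℕ} {ε : ℝ≥0∞} (hε : 0 < ε) {X : G.LieAlg}
    (hX : X ∈ G.layer k) : (X : G.Coord) ∈ adjSpan G ε := by
  induction k generalizing ε X with
  | zero =>
    rw [G.layer_zero, Submodule.mem_bot] at hX
    exact hX ▸ (adjSpan G ε).zero_mem
  | succ k ih =>
    rcases Nat.eq_zero_or_pos k with rfl | hk
    · exact Submodule.subset_span ⟨1, X, hX, by rwa [ccDist_self], by rw [adj_one]; rfl⟩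
    · rw [← G.span_bracket k hk] at hX
      refine Submodule.span_le (p := (adjSpan G ε : Submodule ℝ G.LieAlg)).2 ?_ hX
      rintro _ ⟨X, hX, Y, hY, rfl⟩
      exact lie_mem_adjSpan hε hX (ih (ENNReal.half_pos hε.ne') hY)

theorem adjSpan_eq_top {ε : ℝ≥0∞} (hε : 0 < ε) : adjSpan G ε = ⊤ := by
  have hle : ⨆ k, G.layer k ≤ (adjSpan G ε : Submodule ℝ G.LieAlg) :=
    iSup_le fun _ _ hX => mem_adjSpan_of_mem_layer hε hX
  rw [G.layer_isInternal.submodule_iSup_eq_top] at hle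
  exact eq_top_iff.2 hle

theorem exists_span_adj_eq_top {δ : ℝ≥0∞} (hδ : 0 < δ) : ∃ n ≤ G.dim, ∃ (a : Fin n → G)
    (X : Fin n → G.LieAlg), (∀ i, G.ccDist 1 (a i) < δ) ∧ (∀ i, X i ∈ G.layer 1) ∧
      Submodule.span ℝ (range fun i => adj G.Coord (a i) (X i)) = ⊤ := by
  obtain ⟨Z, hZ, hspan, -⟩ := Submodule.exists_fun_fin_finrank_span_eq ℝ
    {Z : G.Coord | ∃ a : G, ∃ X ∈ G.layer 1, G.ccDist 1 a < δ ∧ adj G.Coord a X = Z}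
  choose a X hX ha hZ using hZ
  refine ⟨_, (Submodule.finrank_le _).trans_eq finrank_euclideanSpace_fin, a, X, ha, hX, ?_⟩
  simp only [hZ]
  exact hspan.trans (adjSpan_eq_top hδ)

theorem map_list_prod_conj_nhds_zero {n : ℕ} {a : Fin n → G} {X : Fin n → G.LieAlg}
    {e : Fin n → ℝ → G} (he : ∀ i, IsLocalExp (e i) (X i))
    (hspan : Submodule.span ℝ (range fun i => adj G.Coord (a i) (X i)) = ⊤) :
    map (fun t : Fin n → ℝ => ((List.finRange n).map fun i => a i * e i (t i) * (a i)⁻¹).prod)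
      (𝓝 0) = 𝓝 1 := by
  let f (i : Fin n) (t : Fin n → ℝ) : G := a i * e i (t i) * (a i)⁻¹
  have hft (i : Fin n) : f i 0 = 1 := by simp [f, (he i).map_zero]
  have hfc (i : Fin n) : ContinuousAt (f i) 0 :=
    (continuousAt_const.mul (ContinuousAt.comp (f := fun t : Fin n → ℝ => t i) (he i).continuousAt
      (continuous_apply i).continuousAt)).mul continuousAt_const
  have hf (i : Fin n) : HasStrictFDerivAt (fun t => chartOne G.Coord G (f i t))
      ((ContinuousLinearMap.toSpanSingleton ℝ (adj G.Coord (a i) (X i))) ∘L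
        ContinuousLinearMap.proj (R := ℝ) (φ := fun _ : Fin n => ℝ) i) 0 :=
    HasStrictFDerivAt.comp (0 : Fin n → ℝ) (f := fun t : Fin n → ℝ => t i)
      ((he i).hasStrictDerivAt_chart_conj (a i)).hasStrictFDerivAt
      (ContinuousLinearMap.proj (R := ℝ) (φ := fun _ : Fin n => ℝ) i).hasStrictFDerivAt
  refine map_nhds_eq_of_hasStrictFDerivAt_chartOne (List.prod_eq_one (by simp [(he _).map_zero]))
    (tendsto_list_prod _ fun i _ => hfc i) (hasStrictFDerivAt_chartOne_list_prod hft hfc hf _) ?_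
  rw [← List.ofFn_eq_map, List.sum_ofFn, LinearMap.range_eq_top]
  intro Z
  obtain ⟨t, ht⟩ := (Submodule.mem_span_range_iff_exists_fun ℝ).1
    (hspan.symm ▸ Submodule.mem_top (x := Z))
  exact ⟨t, by simpa using ht⟩

/-- **Chow's theorem** -/
theorem setOf_ccDist_one_lt_mem_nhds {ε : ℝ≥0∞} (hε : 0 < ε) :
    {g : G | G.ccDist 1 g < ε} ∈ 𝓝 1 := by
  obtain ⟨δ, hδ, hδε⟩ := ENNReal.exists_nnreal_pos_mul_lt (a := 3 * G.dim)
    (ENNReal.mul_ne_top (by simp) (by simp)) hε.ne'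
  have hδ' : (0 : ℝ≥0∞) < δ := by exact_mod_cast hδ
  obtain ⟨n, hn, a, X, ha, hX, hspan⟩ := exists_span_adj_eq_top (G := G) hδ'
  choose e he using fun i => exists_isLocalExp (X i)
  rw [← map_list_prod_conj_nhds_zero he hspan, mem_map]
  have hnear : ∀ᶠ t in 𝓝 (0 : Fin n → ℝ), ∀ i, G.ccDist 1 (e i (t i)) < δ :=
    eventually_all.2 fun i => (((he i).tendsto_ccDist (hX i)).comp
      (tendsto_pi_nhds.1 tendsto_id i)).eventually_lt_const hδ'
  filter_upwards [hnear] with t ht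
  have hconj (i : Fin n) : G.ccDist 1 (a i * e i (t i) * (a i)⁻¹) ≤ 3 * δ :=
    calc G.ccDist 1 (a i * e i (t i) * (a i)⁻¹)
        ≤ 2 * G.ccDist 1 (a i) + G.ccDist 1 (e i (t i)) := ccDist_one_conj_le _ _
      _ ≤ 2 * δ + δ := by gcongr; exacts [(ha i).le, (ht i).le]
      _ = 3 * δ := by ring
  calc G.ccDist 1 _ ≤ n * (3 * δ) := by
        simpa using ccDist_one_list_prod_le (List.finRange n) _ hconj
    _ ≤ G.dim * (3 * δ) := by gcongr
    _ = δ * (3 * G.dim) := by ring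
    _ < ε := hδε

end Chow

end CarnotGroup

/-! ### Kernels of central extensions -/

theorem isPreconnected_preimage_of_isOpenMap {α β : Type*} [TopologicalSpace α]
    [TopologicalSpace β] {f : α → β} {s : Set β} (hs : IsPreconnected s) (hf : IsOpenMap f)
    (hsf : s ⊆ range f) (hfib : ∀ y ∈ s, IsPreconnected (f ⁻¹' {y})) :
    IsPreconnected (f ⁻¹' s) := fun u v hu hv hsuv hsu hsv => by
  replace hsf : f '' f ⁻¹' s = s := image_preimage_eq_of_subset hsf
  obtain ⟨-, hy, ⟨a, hau, rfl⟩, ⟨b, hbv, hb⟩⟩ : (s ∩ (f '' u ∩ f '' v)).Nonempty := by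
    refine hs (f '' u) (f '' v) (hf u hu) (hf v hv) ?_ ?_ ?_
    · simpa only [hsf, image_union] using image_mono (f := f) hsuv
    · simpa only [image_preimage_inter] using hsu.image f
    · simpa only [image_preimage_inter] using hsv.image f
  have hsub : f ⁻¹' {f a} ⊆ f ⁻¹' s := preimage_mono (singleton_subset_iff.2 hy)
  obtain ⟨c, hc, hcuv⟩ := hfib _ hy u v hu hv (hsub.trans hsuv) ⟨a, rfl, hau⟩ ⟨b, hb, hbv⟩
  exact ⟨c, hsub hc, hcuv⟩

theorem isLocallyConstant_of_hasMFDerivAt_zero {E F : Type*} [NormedAddCommGroup E]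
    [NormedSpace ℝ E] [NormedAddCommGroup F] [NormedSpace ℝ F] {M : Type*} [TopologicalSpace M]
    [ChartedSpace E M] [IsManifold 𝓘(ℝ, E) 1 M] {f : M → F}
    (hf : ∀ x, HasMFDerivAt 𝓘(ℝ, E) 𝓘(ℝ, F) f x (0 : E →L[ℝ] F)) : IsLocallyConstant f := by
  refine (IsLocallyConstant.iff_eventually_eq f).2 fun x => ?_
  set c := extChartAt 𝓘(ℝ, E) x
  have hopen : IsOpen c.target := isOpen_extChartAt_target x
  have hderiv : ∀ y ∈ c.target, HasFDerivAt (fun y => f (c.symm y)) (0 : E →L[ℝ] F) y := by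
    intro y hy
    have hsymm : MDifferentiableAt 𝓘(ℝ, E) 𝓘(ℝ, E) c.symm y :=
      ((contMDiffOn_extChartAt_symm (n := 1) x).contMDiffAt
        (hopen.mem_nhds hy)).mdifferentiableAt (by simp)
    exact (hasMFDerivAt_iff_hasFDerivAt.1 (hasMFDerivAt_comp_of_eq (hf (c.symm y))
      hsymm.hasMFDerivAt rfl)).congr_fderiv (ContinuousLinearMap.zero_comp _)
  have hlevel := hopen.isOpen_inter_preimage_of_fderiv_eq_zero
    (fun y hy => (hderiv y hy).differentiableAt.differentiableWithinAt)
    (fun y hy => (hderiv y hy).fderiv) {f x}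
  have hmem : c x ∈ c.target ∩ (fun y => f (c.symm y)) ⁻¹' {f x} :=
    ⟨mem_extChartAt_target x, congrArg f (extChartAt_to_inv x)⟩
  filter_upwards [continuousAt_extChartAt x (hlevel.mem_nhds hmem),
    extChartAt_source_mem_nhds (I := 𝓘(ℝ, E)) x] with z hz hzs
  exact (congrArg f (c.left_inv hzs)).symm.trans hz.2

section LieGroup

variable {E : Type*} [NormedAddCommGroup E] [NormedSpace ℝ E]
  {G : Type*} [TopologicalSpace G] [ChartedSpace E G] [Group G] [LieGroup 𝓘(ℝ, E) ∞ G]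

theorem hasMFDerivAt_adj_apply_of_lieBracketL_eq_zero {Z : E}
    (hZ : ∀ Y, lieBracketL E G Y Z = 0) (g : G) :
    HasMFDerivAt 𝓘(ℝ, E) 𝓘(ℝ, E) (fun h : G => adj E h Z) g (0 : E →L[ℝ] E) := by
  have hone : HasMFDerivAt 𝓘(ℝ, E) 𝓘(ℝ, E) (fun h : G => adj E h Z) 1 (0 : E →L[ℝ] E) := by
    have heval := hasMFDerivAt_comp_of_eq (ContinuousLinearMap.apply ℝ E Z).hasMFDerivAt
      (hasMFDerivAt_adj_one (E := E) (G := G)) rfl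
    exact heval.congr_mfderiv (ContinuousLinearMap.ext hZ)
  have hleft : MDifferentiableAt 𝓘(ℝ, E) 𝓘(ℝ, E) (fun h : G => g⁻¹ * h) g :=
    (contMDiff_mul_left (n := ∞)).mdifferentiable (by simp) g
  have htranslate : (fun h : G => adj E g (adj E (g⁻¹ * h) Z)) = fun h => adj E h Z := by
    ext h
    rw [← ContinuousLinearMap.comp_apply, ← adj_mul, mul_inv_cancel_left]
  have hcomp := hasMFDerivAt_comp_of_eq (adj E g).hasMFDerivAt
    (hasMFDerivAt_comp_of_eq hone hleft.hasMFDerivAt (inv_mul_cancel g)) rfl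
  rw [htranslate] at hcomp
  exact hcomp.congr_mfderiv (ContinuousLinearMap.ext fun _ => map_zero (adj E g))

theorem adj_apply_eq_of_lieBracketL_eq_zero [PreconnectedSpace G] {Z : E}
    (hZ : ∀ Y, lieBracketL E G Y Z = 0) (g : G) : adj E g Z = Z := by
  have : IsManifold 𝓘(ℝ, E) 1 G := IsManifold.of_le (n := ∞) (by norm_num)
  have hconst := isLocallyConstant_of_hasMFDerivAt_zero
    (hasMFDerivAt_adj_apply_of_lieBracketL_eq_zero hZ)
  rw [hconst.apply_eq_of_preconnectedSpace g 1, adj_one, ContinuousLinearMap.id_apply]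

variable [CompleteSpace E]
  {E' : Type*} [NormedAddCommGroup E'] [NormedSpace ℝ E'] [CompleteSpace E']
  {H : Type*} [TopologicalSpace H] [ChartedSpace E' H] [Group H] [LieGroup 𝓘(ℝ, E') ∞ H]

theorem isOpenMap_of_hasMFDerivAt_one (p : G →* H) (hp : ContMDiff 𝓘(ℝ, E) 𝓘(ℝ, E') ∞ p)
    {L : E →L[ℝ] E'} (hL : HasMFDerivAt 𝓘(ℝ, E) 𝓘(ℝ, E') p 1 L) (hs : L.range = ⊤) :
    IsOpenMap p := by
  have : IsTopologicalGroup G := topologicalGroup_of_lieGroup 𝓘(ℝ, E) ∞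
  have : IsTopologicalGroup H := topologicalGroup_of_lieGroup 𝓘(ℝ, E') ∞
  set q : E → H := fun y => p ((chartOne E G).symm y)
  have hq_one : q (coordOne E G) = 1 := by simp [q]
  have hq : ContMDiffAt 𝓘(ℝ, E) 𝓘(ℝ, E') ∞ q (coordOne E G) :=
    hp.contMDiffAt.comp _ contMDiffAt_chartOne_symm
  have hchart : ContMDiffAt 𝓘(ℝ, E') 𝓘(ℝ, E') ∞ (chartOne E' H) 1 := contMDiffAt_extChartAt
  have hderiv : HasFDerivAt (fun y => chartOne E' H (q y)) L (coordOne E G) :=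
    (hasMFDerivAt_one_iff.1 (hasMFDerivAt_comp_of_eq hasMFDerivAt_chartOne hL (map_one p))).2
  have hstrict : HasStrictFDerivAt (fun y => chartOne E' H (q y)) L (coordOne E G) :=
    (hchart.comp_of_eq hq hq_one).contDiffAt.hasStrictFDerivAt' hderiv (by simp)
  have hone : 𝓝 (1 : H) ≤ map p (𝓝 1) := calc
    𝓝 (1 : H) = map q (𝓝 (coordOne E G)) :=
        (map_nhds_eq_of_hasStrictFDerivAt_chartOne hq_one hq.continuousAt hstrict hs).symm
    _ = map p (map (chartOne E G).symm (𝓝 (coordOne E G))) := map_map.symm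
    _ ≤ map p (𝓝 1) := map_mono tendsto_chartOne_symm
  refine isOpenMap_iff_nhds_le.2 fun g => ?_
  have htranslate : p ∘ (g * ·) = (p g * ·) ∘ p := by ext; simp
  rw [← map_mul_left_nhds_one, ← map_mul_left_nhds_one g, map_map, htranslate, ← map_map]
  exact map_mono hone

end LieGroup

theorem eq_of_iSupIndep_of_le_of_iSup_eq_top {ι α : Type*} [CompleteLattice α]
    [IsModularLattice α] {f g : ι → α} (hf : iSupIndep f) (hg : ∀ i, g i ≤ f i)
    (htop : ⨆ i, g i = ⊤) (i : ι) : g i = f i := by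
  have hsup : g i ⊔ ⨆ (j) (_ : j ≠ i), f j = ⊤ := by
    refine eq_top_iff.2 (htop ▸ iSup_le fun j => ?_)
    by_cases hji : j = i
    · exact hji ▸ le_sup_left
    · exact (hg j).trans (le_sup_of_le_right (le_iSup₂_of_le j hji le_rfl))
  refine le_antisymm (hg i) ?_
  calc f i = (g i ⊔ ⨆ (j) (_ : j ≠ i), f j) ⊓ f i := by rw [hsup, top_inf_eq]
    _ = g i ⊔ (⨆ (j) (_ : j ≠ i), f j) ⊓ f i := sup_inf_assoc_of_le _ (hg i)
    _ ≤ g i := by rw [inf_comm, (hf i).eq_bot, sup_bot_eq]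

theorem CarnotGroup.exists_hasMFDerivAt_enorm_le_ccDist_sq {G : CarnotGroup.{u}}
    {l : G.Coord →L[ℝ] ℝ} (hl : ∀ X : G.LieAlg, X ∈ G.layer 1 → l X = 0) :
    ∃ (φ : G → ℝ) (C : ℝ≥0), φ 1 = 0 ∧ HasMFDerivAt G.model 𝓘(ℝ, ℝ) φ 1 l ∧
      ∀ g, ‖φ g‖ₑ ≤ C * G.ccDist 1 g ^ 2 := by
  obtain ⟨f, -⟩ := (SmoothBumpFunction.nhds_basis_support (I := G.model) (c := (1 : G))
    univ_mem).ex_mem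
  let q : G.Coord → ℝ := fun y => l (y - coordOne G.Coord G)
  set φ : G → ℝ := fun g => f g • q (chartOne G.Coord G g)
  have hφ : ContMDiff G.model 𝓘(ℝ, ℝ) ∞ φ := by
    have hq : ContMDiff G.model 𝓘(ℝ, ℝ) ∞ q :=
      (l.contDiff.comp (contDiff_id.sub contDiff_const)).contMDiff
    exact f.contMDiff_smul (hq.comp_contMDiffOn contMDiffOn_extChartAt)
  have hφ_one : φ 1 = 0 := by simp [φ, q]
  have hderiv : HasMFDerivAt G.model 𝓘(ℝ, ℝ) φ 1 l := by
    have hq : HasFDerivAt q l (coordOne G.Coord G) :=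
      l.hasFDerivAt.comp _ ((hasFDerivAt_id _).sub_const _)
    refine (hasMFDerivAt_comp_of_eq hq.hasMFDerivAt
      hasMFDerivAt_chartOne rfl).congr_of_eventuallyEq ?_
    filter_upwards [f.eventuallyEq_one] with g hg
    simp [φ, hg]
  have hleft : leftDiff G.Coord φ 1 = l := by
    refine hasMFDerivAt_unique (hasMFDerivAt_leftDiff hφ 1) ?_
    exact hderiv.congr_of_eventuallyEq (.of_forall fun y => congrArg φ (one_mul y))
  obtain ⟨C, hC⟩ := exists_abs_sub_le_ccDist_sq hφ f.hasCompactSupport.smul_right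
    fun X hX => hleft ▸ hl X hX
  refine ⟨φ, C, hφ_one, hderiv, fun g => ?_⟩
  simpa [hφ_one, Real.enorm_eq_ofReal_abs] using hC g

namespace CentralExtension

variable {V : Type w} [NormedAddCommGroup V] [InnerProductSpace ℝ V] [FiniteDimensional ℝ V]
  {G : CarnotGroup.{u}} {H : CarnotGroup.{v}} (E : CentralExtension V G H)

section Kernel

theorem incl_zero : E.incl 0 = 1 :=
  left_eq_mul.1 (show E.incl 0 = E.incl 0 * E.incl 0 by rw [← E.incl_add, add_zero])

/-- The inclusion of the kernel as a homomorphism, with `V` written multiplicatively. -/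
def inclHom : Multiplicative V →* G where
  toFun v := E.incl v.toAdd
  map_one' := E.incl_zero
  map_mul' v w := E.incl_add v.toAdd w.toAdd

theorem incl_neg (v : V) : E.incl (-v) = (E.incl v)⁻¹ :=
  map_inv E.inclHom (Multiplicative.ofAdd v)

theorem proj_incl (v : V) : E.proj (E.incl v) = 1 := (E.exact _).2 ⟨v, rfl⟩

theorem proj_mul_incl (g : G) (v : V) : E.proj (g * E.incl v) = E.proj g := by
  rw [map_mul, E.proj_incl, mul_one]

theorem comap_incl_nhds_one_le : comap E.incl (𝓝 1) ≤ 𝓝 0 := by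
  let f : Multiplicative V →* E.proj.ker :=
    E.inclHom.codRestrict E.proj.ker fun v => E.proj_incl v.toAdd
  have hcont : Continuous f := (E.incl_smooth.continuous.comp continuous_toAdd).subtype_mk _
  have hsurj : Function.Surjective f := by
    rintro ⟨g, hg⟩
    obtain ⟨v, rfl⟩ := (E.exact g).1 hg
    exact ⟨Multiplicative.ofAdd v, rfl⟩
  have hopen : IsOpenMap f := by
    have : ProperSpace V := FiniteDimensional.proper_real V
    have : SigmaCompactSpace (Multiplicative V) := inferInstanceAs (SigmaCompactSpace V)
    have hker : IsClosed (E.proj.ker : Set G) :=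
      isClosed_singleton.preimage E.proj_smooth.continuous
    have : LocallyCompactSpace E.proj.ker := hker.locallyCompactSpace
    exact f.isOpenMap_of_sigmaCompact hsurj hcont
  intro U hU
  have himage : f '' (Multiplicative.toAdd ⁻¹' U) ∈ 𝓝 (1 : E.proj.ker) := by
    have hone : Multiplicative.toAdd ⁻¹' U ∈ 𝓝 (1 : Multiplicative V) :=
      continuous_toAdd.continuousAt (by exact hU)
    simpa using hopen.image_mem_nhds hone
  rw [nhds_subtype_eq_comap] at himage
  obtain ⟨W, hW, hWU⟩ := himage
  refine ⟨W, hW, fun v hv => ?_⟩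
  obtain ⟨w, hw, hwv⟩ := hWU (show f (Multiplicative.ofAdd v) ∈ Subtype.val ⁻¹' W from hv)
  obtain rfl : w.toAdd = v := E.incl_injective (congrArg Subtype.val hwv)
  exact hw

theorem continuous_of_tendsto_incl {W : Type*} [AddCommGroup W] [TopologicalSpace W]
    [IsTopologicalAddGroup W] (A : W →+ V)
    (hA : Tendsto (fun w => E.incl (A w)) (𝓝 0) (𝓝 1)) : Continuous A := by
  refine continuous_of_continuousAt_zero A ?_
  rw [ContinuousAt, map_zero]
  exact (tendsto_comap_iff.2 hA).mono_right E.comap_incl_nhds_one_le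

theorem exists_continuousLinearMap_incl_eq_conj (g : G) :
    ∃ A : V →L[ℝ] V, ∀ v, E.incl (A v) = g * E.incl v * g⁻¹ := by
  have hker (v) : ∃ w, E.incl w = g * E.incl v * g⁻¹ := (E.exact _).1 (by simp [E.proj_incl])
  choose A hA using hker
  let A' : V →+ V := AddMonoidHom.mk' A fun v w => E.incl_injective (by
    rw [hA, E.incl_add, E.incl_add, hA, hA]; group)
  have hconj : Continuous fun v => g * E.incl v * g⁻¹ :=
    (continuous_const.mul E.incl_smooth.continuous).mul continuous_const
  have htendsto : Tendsto (fun v => E.incl (A' v)) (𝓝 0) (𝓝 1) :=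
    (hconj.tendsto' 0 1 (by simp [E.incl_zero])).congr fun v => (hA v).symm
  exact ⟨A'.toRealLinearMap (E.continuous_of_tendsto_incl A' htendsto), hA⟩

end Kernel

section Differential

/-- The differential `ι_* : V → 𝔤` of the inclusion. -/
def inclLie : V →ₗ[ℝ] G.LieAlg := E.split.symm.toLinearMap ∘ₗ LinearMap.inr ℝ H.LieAlg V

/-- The differential `π_* : 𝔤 → 𝔥` of the projection. -/
def projLie : G.LieAlg →ₗ[ℝ] H.LieAlg := LinearMap.fst ℝ H.LieAlg V ∘ₗ E.split.toLinearMap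

theorem inclLie_injective : Function.Injective E.inclLie :=
  E.split.symm.injective.comp LinearMap.inr_injective

theorem projLie_surjective : Function.Surjective E.projLie :=
  fun Y => ⟨E.split.symm (Y, 0), by simp [projLie]⟩

theorem projLie_inclLie (v : V) : E.projLie (E.inclLie v) = 0 := by
  simp [projLie, inclLie]

theorem lie_inclLie (Y : G.LieAlg) (v : V) : ⁅Y, E.inclLie v⁆ = 0 := by
  have : LieGroup H.model (minSmoothness ℝ 3) H := by
    rw [minSmoothness_of_isRCLikeNormedField]; infer_instance
  refine E.split.injective ?_
  rw [E.split_bracket, show E.split (E.inclLie v) = (0, v) from E.split.apply_symm_apply _]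
  exact (Prod.ext (lie_zero _) (map_zero _)).trans (map_zero E.split).symm

theorem exists_hasMFDerivAt_incl : ∃ L : V →L[ℝ] G.Coord,
    HasMFDerivAt 𝓘(ℝ, V) G.model E.incl 0 L ∧ ∀ v, L v = E.inclLie v :=
  ⟨mfderiv 𝓘(ℝ, V) G.model E.incl 0,
    (E.incl_smooth.mdifferentiable (by simp) (0 : V)).hasMFDerivAt, E.mfderiv_incl⟩

theorem incl_comm (g : G) (v : V) : g * E.incl v = E.incl v * g := by
  obtain ⟨A, hA⟩ := E.exists_continuousLinearMap_incl_eq_conj g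
  obtain ⟨L, hL, hL_apply⟩ := E.exists_hasMFDerivAt_incl
  have hcomp_right : HasMFDerivAt 𝓘(ℝ, V) G.model (fun v => E.incl (A v)) 0 (L ∘L A) :=
    hasMFDerivAt_comp_of_eq hL A.hasMFDerivAt (map_zero A)
  have hcomp_left := hasMFDerivAt_comp_of_eq (hasMFDerivAt_conj (E := G.Coord) g) hL E.incl_zero
  rw [← funext hA] at hcomp_left
  have hderiv : L (A v) = adj G.Coord g (L v) :=
    DFunLike.congr_fun (hasMFDerivAt_unique hcomp_right hcomp_left) v
  have hadj : adj G.Coord g (L v) = L v := by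
    refine adj_apply_eq_of_lieBracketL_eq_zero (fun Y => ?_) g
    rw [hL_apply]
    exact (lieBracketL_apply _ _).trans (E.lie_inclLie Y v)
  have hfix : A v = v := E.inclLie_injective
    ((hL_apply _).symm.trans ((hderiv.trans hadj).trans (hL_apply v)))
  have hconj := hA v
  rw [hfix] at hconj
  exact (eq_mul_inv_iff_mul_eq.1 hconj).symm

theorem isOpenMap_proj : IsOpenMap E.proj := by
  refine isOpenMap_of_hasMFDerivAt_one E.proj E.proj_smooth
    (E.proj_smooth.mdifferentiable (by simp) 1).hasMFDerivAt (LinearMap.range_eq_top.2 fun Y => ?_)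
  obtain ⟨X, hX⟩ := E.projLie_surjective Y
  exact ⟨X, (E.mfderiv_proj X).trans hX⟩

theorem preimage_proj_singleton (g : G) :
    E.proj ⁻¹' {E.proj g} = range fun v => g * E.incl v := by
  ext h
  refine ⟨fun hh => ?_, ?_⟩
  · obtain ⟨v, hv⟩ := (E.exact (g⁻¹ * h)).1 (by simp [mem_singleton_iff.1 hh])
    exact ⟨v, (congrArg (g * ·) hv).trans (mul_inv_cancel_left g h)⟩
  · rintro ⟨v, rfl⟩
    exact E.proj_mul_incl g v

theorem isPreconnected_preimage_proj {U : Set H} (hU : IsPreconnected U) :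
    IsPreconnected (E.proj ⁻¹' U) := by
  refine isPreconnected_preimage_of_isOpenMap hU E.isOpenMap_proj
    (fun y _ => E.proj_surjective y) fun y _ => ?_
  obtain ⟨g, rfl⟩ := E.proj_surjective y
  rw [preimage_proj_singleton]
  exact isPreconnected_range (continuous_const.mul E.incl_smooth.continuous)

end Differential

section EqualRank

theorem map_projLie_layer (k : ℕ) : (G.layer k).map E.projLie = H.layer k := by
  refine eq_of_iSupIndep_of_le_of_iSup_eq_top H.layer_isInternal.submodule_iSupIndep
    (fun k => Submodule.map_le_iff_le_comap.2 (E.proj_graded k)) ?_ k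
  rw [← Submodule.map_iSup, G.layer_isInternal.submodule_iSup_eq_top, Submodule.map_top]
  exact LinearMap.range_eq_top.2 E.projLie_surjective

theorem eq_zero_of_inclLie_mem_layer_one (hrank : G.rank = H.rank) {v : V}
    (hv : E.inclLie v ∈ G.layer 1) : v = 0 := by
  let p : G.layer 1 →ₗ[ℝ] H.layer 1 := E.projLie.restrict (E.proj_graded 1)
  have hsurj : Function.Surjective p := by
    rintro ⟨Y, hY⟩
    obtain ⟨X, hX, rfl⟩ := (E.map_projLie_layer 1).symm ▸ hY
    exact ⟨⟨X, hX⟩, rfl⟩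
  have hinj := (LinearMap.injective_iff_surjective_of_finrank_eq_finrank hrank).2 hsurj
  have hzero : (⟨E.inclLie v, hv⟩ : G.layer 1) = 0 :=
    (map_eq_zero_iff p hinj).1 (Subtype.ext (E.projLie_inclLie v))
  exact (map_eq_zero_iff E.inclLie E.inclLie_injective).1 (congrArg Subtype.val hzero)

theorem exists_retraction (hrank : G.rank = H.rank) : ∃ P : G.LieAlg →ₗ[ℝ] V,
    (∀ v, P (E.inclLie v) = v) ∧ ∀ X ∈ G.layer 1, P X = 0 := by
  obtain ⟨Q, hQ⟩ := ((G.layer 1).mkQ ∘ₗ E.inclLie).exists_leftInverse_of_injective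
    (LinearMap.ker_eq_bot'.2 fun v hv => E.eq_zero_of_inclLie_mem_layer_one hrank
      ((Submodule.Quotient.mk_eq_zero _).1 hv))
  refine ⟨Q ∘ₗ (G.layer 1).mkQ, LinearMap.congr_fun hQ, fun X hX => ?_⟩
  rw [LinearMap.comp_apply, Submodule.mkQ_apply, (Submodule.Quotient.mk_eq_zero _).2 hX, map_zero]

theorem exists_hasFDerivAt_enorm_le_ccDist_sq (hrank : G.rank = H.rank) :
    ∃ (B : V ≃L[ℝ] Fin (Module.finrank ℝ V) → ℝ) (q : V → Fin (Module.finrank ℝ V) → ℝ) (C : ℝ≥0),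
      q 0 = 0 ∧ HasFDerivAt q (B : V →L[ℝ] Fin (Module.finrank ℝ V) → ℝ) 0 ∧
      ∀ v i, ‖q v i‖ₑ ≤ C * G.ccDist 1 (E.incl v) ^ 2 := by
  obtain ⟨P, hP_incl, hP_layer⟩ := E.exists_retraction hrank
  obtain ⟨L, hL, hL_apply⟩ := E.exists_hasMFDerivAt_incl
  let B := (Module.finBasis ℝ V).equivFunL
  let l (i) : G.Coord →L[ℝ] ℝ := LinearMap.toContinuousLinearMap
    (LinearMap.proj i ∘ₗ B.toLinearMap ∘ₗ P : G.LieAlg →ₗ[ℝ] ℝ)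
  have hl (i) (X : G.LieAlg) (hX : X ∈ G.layer 1) : l i X = 0 := by
    change B (P X) i = 0
    rw [hP_layer X hX, map_zero, Pi.zero_apply]
  choose φ C hφ_one hφ hC using fun i => CarnotGroup.exists_hasMFDerivAt_enorm_le_ccDist_sq (hl i)
  refine ⟨B, fun v i => φ i (E.incl v), ∑ i, C i,
    funext fun i => (congrArg (φ i) E.incl_zero).trans (hφ_one i),
    hasFDerivAt_pi'.2 fun i => ?_, fun v i => (hC i _).trans ?_⟩
  · refine (hasMFDerivAt_iff_hasFDerivAt.1
      (hasMFDerivAt_comp_of_eq (hφ i) hL E.incl_zero)).congr_fderiv ?_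
    ext v
    exact congrArg (fun w => B w i) ((congrArg P (hL_apply v)).trans (hP_incl v))
  · gcongr
    exact Finset.single_le_sum_of_canonicallyOrdered (Finset.mem_univ i)

theorem exists_enorm_le_ccDist_sq (hrank : G.rank = H.rank) : ∃ C ε : ℝ≥0, 0 < ε ∧
    ∀ v, G.ccDist 1 (E.incl v) < ε → ‖v‖ₑ ≤ C * G.ccDist 1 (E.incl v) ^ 2 := by
  obtain ⟨B, q, C, hq_zero, hq, hC⟩ := E.exists_hasFDerivAt_enorm_le_ccDist_sq hrank
  obtain ⟨c, hc0, hc⟩ := (hq.isTheta_sub B.toHomeomorph.isInducing).isBigO_symm.exists_nonneg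
  lift c to ℝ≥0 using hc0
  obtain ⟨W, hW, hWc⟩ := E.comap_incl_nhds_one_le hc.bound
  obtain ⟨ε, hε, hεW⟩ := CarnotGroup.exists_ccDist_lt_subset hW
  refine ⟨c * C, ε, hε, fun v hv => ?_⟩
  have hvq : ‖v‖₊ ≤ c * ‖q v‖₊ := by
    have h : ‖v - 0‖ ≤ c * ‖q v - q 0‖ := hWc (hεW _ hv)
    rw [sub_zero, hq_zero, sub_zero] at h
    exact_mod_cast h
  have hqv := hC v
  lift G.ccDist 1 (E.incl v) to ℝ≥0 using hv.ne_top with d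
  have hqd : ‖q v‖₊ ≤ C * d ^ 2 := pi_nnnorm_le_iff.2 fun i => by exact_mod_cast hqv i
  have hv_le : ‖v‖₊ ≤ c * C * d ^ 2 := (hvq.trans (by gcongr)).trans_eq (mul_assoc _ _ _).symm
  rw [enorm_eq_nnnorm]
  exact_mod_cast hv_le

end EqualRank

end CentralExtension

/-! ### Hölder maps -/

namespace CarnotGroup

variable {G : CarnotGroup.{u}}

theorem ccDist_mul_right_self (x y : G) : G.ccDist x (x * y) = G.ccDist 1 y := by
  rw [← ccDist_mul_left x 1 y, mul_one]

theorem ccDist_eq_ccDist_one_inv_mul (x y : G) : G.ccDist x y = G.ccDist 1 (x⁻¹ * y) := by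
  rw [← ccDist_mul_right_self x, mul_inv_cancel_left]

theorem tendsto_ccDist_one : Tendsto (G.ccDist 1) (𝓝 1) (𝓝 0) :=
  ENNReal.nhds_zero_basis.tendsto_right_iff.2 fun _ hε => setOf_ccDist_one_lt_mem_nhds hε

theorem setOf_ccDist_lt_mem_nhds (x : G) {ε : ℝ≥0∞} (hε : 0 < ε) :
    {g : G | G.ccDist x g < ε} ∈ 𝓝 x := by
  have htranslate : Tendsto (fun g => x⁻¹ * g) (𝓝 x) (𝓝 1) :=
    (continuous_const_mul x⁻¹).tendsto' _ _ (inv_mul_cancel x)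
  filter_upwards [(tendsto_ccDist_one.comp htranslate).eventually_lt_const hε] with g hg
  exact (ccDist_eq_ccDist_one_inv_mul x g).trans_lt hg

theorem exists_ccDist_lt_subset_of_mem_nhds {x : G} {U : Set G} (hU : U ∈ 𝓝 x) :
    ∃ ε : ℝ≥0, 0 < ε ∧ ∀ g, G.ccDist x g < ε → g ∈ U := by
  obtain ⟨ε, hε, hsub⟩ := exists_ccDist_lt_subset
    ((continuous_const_mul x).tendsto' 1 x (mul_one x) hU)
  refine ⟨ε, hε, fun g hg => ?_⟩
  rw [ccDist_eq_ccDist_one_inv_mul] at hg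
  simpa only [mem_preimage, mul_inv_cancel_left] using hsub _ hg

theorem tendsto_one_of_tendsto_ccDist {ι : Type*} {F : Filter ι} {f : ι → G}
    (hf : Tendsto (fun i => G.ccDist 1 (f i)) F (𝓝 0)) : Tendsto f F (𝓝 1) := by
  intro U hU
  obtain ⟨ε, hε, hsub⟩ := exists_ccDist_lt_subset hU
  exact (hf.eventually_lt_const (ENNReal.coe_pos.2 hε)).mono fun i hi => hsub _ hi

end CarnotGroup

namespace CentralExtension

open CarnotGroup

variable {V : Type w} [NormedAddCommGroup V] [InnerProductSpace ℝ V] [FiniteDimensional ℝ V]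
  {G : CarnotGroup.{u}} {H : CarnotGroup.{v}} (E : CentralExtension V G H)

theorem ccDist_incl (v w : V) : G.ccDist (E.incl v) (E.incl w) = G.ccDist 1 (E.incl (v - w)) := by
  rw [ccDist_comm, ccDist_eq_ccDist_one_inv_mul, ← E.incl_neg, ← E.incl_add, neg_add_eq_sub]

section HolderToKernel

variable {G' : CarnotGroup} {S : Set G'} {h : G' → V} {β : ℝ}

-- `|h(γ s) - h(γ t)| ≲ d(h(γ s), h(γ t))² ≲ d(γ s, γ t)^(2β)`, and `2β > 1`
theorem eq_of_isHolderOn_of_isHorizontal (hrank : G.rank = H.rank) (hβ : 1 / 2 < β)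
    (hh : IsHolderOn β S fun g => E.incl (h g)) {γ : ℝ → G'} (hγ : G'.IsHorizontal γ)
    (hlen : G'.length γ ≠ ⊤) (hS : ∀ t ∈ Icc (0 : ℝ) 1, γ t ∈ S) : h (γ 0) = h (γ 1) := by
  obtain ⟨C, hC⟩ := hh
  obtain ⟨K, ε, hε, hK⟩ := E.exists_enorm_le_ccDist_sq hrank
  obtain ⟨δ, hδ, hδε⟩ := ENNReal.nhds_zero_basis.eventually_iff.1
    ((ENNReal.tendsto_const_mul_rpow_nhds_zero_of_pos (c := C) ENNReal.coe_ne_top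
      (one_half_pos.trans hβ)).eventually_lt_const (ENNReal.coe_pos.2 hε))
  refine eq_of_edist_le_setLIntegral_rpow (f := fun t => h (γ t)) (α := 2 * β) (K := K * C ^ 2)
    hlen (by linarith) hδ fun s hs t ht hst hsmall => ?_
  have hdist : G.ccDist 1 (E.incl (h (γ s) - h (γ t))) ≤ C * lengthOn γ (Icc s t) ^ β := by
    rw [← E.ccDist_incl]
    refine (hC _ (hS s hs) _ (hS t ht)).trans ?_
    have hlength := ccDist_le_lengthOn hγ hs ht
    rw [uIcc_of_le hst] at hlength
    gcongr
  calc edist (h (γ s)) (h (γ t)) = ‖h (γ s) - h (γ t)‖ₑ := edist_eq_enorm_sub _ _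
    _ ≤ K * G.ccDist 1 (E.incl (h (γ s) - h (γ t))) ^ 2 := hK _ (hdist.trans_lt (hδε hsmall))
    _ ≤ K * (C * lengthOn γ (Icc s t) ^ β) ^ 2 := by gcongr
    _ = (K * C ^ 2 : ℝ≥0) * lengthOn γ (Icc s t) ^ (2 * β) := by
      rw [mul_pow, ← ENNReal.rpow_mul_natCast, mul_comm β]
      push_cast
      rw [mul_assoc]

theorem eq_of_isHolderOn_of_ccDist_lt (hrank : G.rank = H.rank) (hβ : 1 / 2 < β)
    (hh : IsHolderOn β S fun g => E.incl (h g)) {r : ℝ≥0∞} {x y : G'}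
    (hS : ∀ g, G'.ccDist x g < r → g ∈ S) (hy : G'.ccDist x y < r) : h x = h y := by
  obtain ⟨γ, hγ, rfl, rfl, hlen⟩ := exists_length_lt_of_ccDist_lt hy
  exact E.eq_of_isHolderOn_of_isHorizontal hrank hβ hh hγ hlen.ne_top fun t ht =>
    hS _ ((hγ.ccDist_le_length ht).trans_lt hlen)

theorem eq_of_isHolderOn_ball (hrank : G.rank = H.rank) (hβ : 1 / 2 < β) {x : G'} {r : ℝ}
    (hh : IsHolderOn β (G'.ball x r) fun g => E.incl (h g)) {p q : G'}
    (hp : p ∈ G'.ball x r) (hq : q ∈ G'.ball x r) : h p = h q :=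
  (E.eq_of_isHolderOn_of_ccDist_lt hrank hβ hh (fun _ => id) hp).symm.trans
    (E.eq_of_isHolderOn_of_ccDist_lt hrank hβ hh (fun _ => id) hq)

theorem eq_of_isHolderOn_of_isPreconnected (hrank : G.rank = H.rank) (hβ : 1 / 2 < β)
    (hh : IsHolderOn β S fun g => E.incl (h g)) (hS : IsOpen S) (hSc : IsPreconnected S) {p q : G'}
    (hp : p ∈ S) (hq : q ∈ S) : h p = h q := by
  refine hSc.induction₂ (fun p q => h p = h q) (fun p hp => nhdsWithin_le_nhds ?_)
    (fun _ _ _ _ _ _ => Eq.trans) (fun _ _ _ _ => Eq.symm) hp hq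
  obtain ⟨ε, hε, hsub⟩ := exists_ccDist_lt_subset_of_mem_nhds (hS.mem_nhds hp)
  filter_upwards [setOf_ccDist_lt_mem_nhds p (ENNReal.coe_pos.2 hε)] with q hq
  exact E.eq_of_isHolderOn_of_ccDist_lt hrank hβ hh hsub hq

end HolderToKernel

section HolderLift

theorem ccDist_mul_incl (x y : G) (v : V) :
    G.ccDist (x * E.incl v) (y * E.incl v) = G.ccDist x y := by
  rw [E.incl_comm, E.incl_comm, ccDist_mul_left]

theorem ccDist_incl_le (a b : G) (v w : V) : G.ccDist (E.incl v) (E.incl w) ≤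
    G.ccDist a b + G.ccDist (a * E.incl v) (b * E.incl w) := by
  calc G.ccDist (E.incl v) (E.incl w) = G.ccDist (a * E.incl v) (a * E.incl w) :=
        (ccDist_mul_left a _ _).symm
    _ ≤ G.ccDist (a * E.incl v) (b * E.incl w) + G.ccDist (b * E.incl w) (a * E.incl w) :=
        ccDist_triangle _ _ _
    _ = G.ccDist a b + G.ccDist (a * E.incl v) (b * E.incl w) := by
        rw [E.ccDist_mul_incl, ccDist_comm b a, add_comm]

variable {V₁ : Type*} [NormedAddCommGroup V₁] [InnerProductSpace ℝ V₁] [FiniteDimensional ℝ V₁]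
  {G₁ H₁ : CarnotGroup} (E₁ : CentralExtension V₁ G₁ H₁) {β : ℝ} {U : Set H₁} {F : G₁ → G}

theorem exists_map_mul_incl_eq_of_isHolderOn (hrank : G.rank = H.rank) (hβ : 1 / 2 < β)
    {f : H₁ → H} (hU : IsOpen U) (hUc : IsConnected U) (hF : IsHolderOn β (E₁.proj ⁻¹' U) F)
    (hlift : ∀ g ∈ E₁.proj ⁻¹' U, E.proj (F g) = f (E₁.proj g)) (k : V₁) :
    ∃ v, ∀ g ∈ E₁.proj ⁻¹' U, F (g * E₁.incl k) = F g * E.incl v := by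
  have hmem (g) (hg : g ∈ E₁.proj ⁻¹' U) : g * E₁.incl k ∈ E₁.proj ⁻¹' U := by
    rwa [mem_preimage, E₁.proj_mul_incl]
  have hfiber (g) (hg : g ∈ E₁.proj ⁻¹' U) : ∃ v, F g * E.incl v = F (g * E₁.incl k) := by
    refine (E.preimage_proj_singleton (F g)).subset (mem_singleton_iff.2 ?_)
    rw [hlift _ (hmem g hg), hlift g hg, E₁.proj_mul_incl]
  choose! h hh using hfiber
  have hholder : IsHolderOn β (E₁.proj ⁻¹' U) fun g => E.incl (h g) := by
    obtain ⟨C, hC⟩ := hF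
    refine ⟨C + C, fun p hp q hq => ?_⟩
    calc G.ccDist (E.incl (h p)) (E.incl (h q))
        ≤ G.ccDist (F p) (F q) + G.ccDist (F (p * E₁.incl k)) (F (q * E₁.incl k)) := by
          rw [← hh p hp, ← hh q hq]
          exact E.ccDist_incl_le (F p) (F q) _ _
      _ ≤ C * G₁.ccDist p q ^ β + C * G₁.ccDist (p * E₁.incl k) (q * E₁.incl k) ^ β :=
          add_le_add (hC p hp q hq) (hC _ (hmem p hp) _ (hmem q hq))
      _ = (C + C : ℝ≥0) * G₁.ccDist p q ^ β := by
          rw [E₁.ccDist_mul_incl, ENNReal.coe_add, add_mul]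
  obtain ⟨g₀, hg₀⟩ := hUc.nonempty.preimage E₁.proj_surjective
  refine ⟨h g₀, fun g hg => ?_⟩
  rw [← hh g hg, E.eq_of_isHolderOn_of_isPreconnected hrank hβ hholder
    (hU.preimage E₁.proj_smooth.continuous)
    (E₁.isPreconnected_preimage_proj hUc.isPreconnected) hg hg₀]

theorem tendsto_incl_of_isHolderOn (hβ : 0 < β) {S : Set G₁} (hF : IsHolderOn β S F) {g : G₁}
    (hS : ∀ k, g * E₁.incl k ∈ S) {Φ : V₁ → V}
    (hΦ : ∀ k, F (g * E₁.incl k) = F g * E.incl (Φ k)) :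
    Tendsto (fun k => E.incl (Φ k)) (𝓝 0) (𝓝 1) := by
  obtain ⟨C, hC⟩ := hF
  have hg : g ∈ S := by simpa [E₁.incl_zero] using hS 0
  have hdist (k) : G.ccDist 1 (E.incl (Φ k)) ≤ C * G₁.ccDist 1 (E₁.incl k) ^ β := by
    simpa only [hΦ, ccDist_mul_right_self] using hC g hg _ (hS k)
  have hbound : Tendsto (fun k => (C : ℝ≥0∞) * G₁.ccDist 1 (E₁.incl k) ^ β) (𝓝 0) (𝓝 0) :=
    (ENNReal.tendsto_const_mul_rpow_nhds_zero_of_pos ENNReal.coe_ne_top hβ).comp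
      (tendsto_ccDist_one.comp (E₁.incl_smooth.continuous.tendsto' 0 1 E₁.incl_zero))
  exact tendsto_one_of_tendsto_ccDist (tendsto_of_tendsto_of_tendsto_of_le_of_le
    tendsto_const_nhds hbound (fun _ => zero_le) hdist)

theorem exists_hom_of_isHolderOn (hrank : G.rank = H.rank) (hβ : 1 / 2 < β) {f : H₁ → H}
    (hU : IsOpen U) (hUc : IsConnected U) (hF : IsHolderOn β (E₁.proj ⁻¹' U) F)
    (hlift : ∀ g ∈ E₁.proj ⁻¹' U, E.proj (F g) = f (E₁.proj g)) :
    ∃ Φ : V₁ →+ V, ContDiff ℝ ∞ Φ ∧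
      ∀ g ∈ E₁.proj ⁻¹' U, ∀ k : V₁, F (g * E₁.incl k) = F g * E.incl (Φ k) := by
  choose φ hφ using E.exists_map_mul_incl_eq_of_isHolderOn E₁ hrank hβ hU hUc hF hlift
  obtain ⟨g, hg⟩ := hUc.nonempty.preimage E₁.proj_surjective
  have hmem (k) : g * E₁.incl k ∈ E₁.proj ⁻¹' U := by
    rwa [mem_preimage, E₁.proj_mul_incl]
  have hadd (k l) : φ (k + l) = φ k + φ l := by
    refine E.incl_injective (mul_left_cancel (a := F g) ?_)
    rw [← hφ _ _ hg, E₁.incl_add, ← mul_assoc, hφ l _ (hmem k), hφ k g hg, E.incl_add, mul_assoc]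
  let Φ : V₁ →+ V := AddMonoidHom.mk' φ hadd
  have hcont : Continuous Φ := E.continuous_of_tendsto_incl Φ
    (E.tendsto_incl_of_isHolderOn E₁ (one_half_pos.trans hβ) hF hmem fun k => hφ k g hg)
  exact ⟨Φ, (Φ.toRealLinearMap hcont).contDiff, fun g hg k => hφ k g hg⟩

end HolderLift

end CentralExtension

end

theorem theorem6p6 {V₁ V₂ : Type*}
    [NormedAddCommGroup V₁] [InnerProductSpace ℝ V₁] [FiniteDimensional ℝ V₁]
    [NormedAddCommGroup V₂] [InnerProductSpace ℝ V₂] [FiniteDimensional ℝ V₂]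
    (G₁ H₁ G₂ H₂ : CarnotGroup)
    (E₁ : CentralExtension V₁ G₁ H₁) (E₂ : CentralExtension V₂ G₂ H₂)
    (hrank : G₂.rank = H₂.rank)
    (β : ℝ) (hβ : 1 / 2 < β) (hβ' : β ≤ 1) :
    (∀ (U₁ : Set H₁) (f : H₁ → H₂) (F : G₁ → G₂), IsOpen U₁ → IsConnected U₁ →
      (∃ γ : ℝ, 0 < γ ∧ γ ≤ 1 ∧ CarnotGroup.IsHolderOn γ U₁ f) →
      CarnotGroup.IsHolderOn β (E₁.proj ⁻¹' U₁) F →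
      (∀ g ∈ E₁.proj ⁻¹' U₁, E₂.proj (F g) = f (E₁.proj g)) →
      ∃ Φ : V₁ →+ V₂, ContDiff ℝ ∞ Φ ∧
        ∀ g ∈ E₁.proj ⁻¹' U₁, ∀ k : V₁, F (g * E₁.incl k) = F g * E₂.incl (Φ k)) ∧
    (∀ (x : G₁) (r : ℝ) (h : G₁ → V₂),
      CarnotGroup.IsHolderOn β (G₁.ball x r) (fun g => E₂.incl (h g)) →
      ∀ p ∈ G₁.ball x r, ∀ q ∈ G₁.ball x r, h p = h q) := by
  refine ⟨fun U₁ f F hU hUc _ hF hlift => ?_, fun x r h hh p hp q hq => ?_⟩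
  · exact E₂.exists_hom_of_isHolderOn E₁ hrank hβ hU hUc hF hlift
  · exact E₂.eq_of_isHolderOn_ball hrank hβ hh hp hq
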